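/- Let $N\ge 1$ and let $c_N:=\pi^{-N/2}\Gamma(N/2)$ and $\rho_N:=2\log 2+\psi(N/2)-\gamma$ (with $\psi=\Gamma'/\Gamma$ and $\gamma$ the Euler–Mascheroni constant) be the constants of the logarithmic Laplacian $L_\Delta$ on $\mathbb R^N$ (the operator with symbol $2\log|\xi|$). Put $$k(z):=\frac{c_N}{|z|^N}\chi_{B_1}(z),\qquad j(z):=\frac{c_N}{|z|^N}\chi_{\mathbb R^N\setminus B_1}(z),$$ $$\mathcal E(u,v):=\frac12\iint_{\mathbb R^N\times\mathbb R^N}(u(x)-u(y))(v(x)-v(y))\,k(x-y)\,dx\,dy,$$ let $\mathbb H(\mathbb R^N)$ be the space of measurable $u\in L^2(\mathbb R^N)$ with $\mathcal E(u,u)<\infty$, and, for an open set $\Omega\subset\mathbb R^N$, let $\mathbb H(\Omega)$ be the space of $u\in\mathbb H(\mathbb R^N)$ with $u=0$ a.e. in $\mathbb R^N\setminus\Omega$. The bilinear form of $L_\Delta$ is $$\mathcal E_L(u,v):=\mathcal E(u,v)-\iint_{\mathbb R^N\times\mathbb R^N}u(x)v(y)\,j(x-y)\,dx\,dy+\rho_N\int_{\mathbb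 R^N}uv\,dx .$$ For $g\in L^2(\Omega)$, a function $u\in\mathbb H(\mathbb R^N)$ is a weak solution of $L_\Delta u=g$ in $\Omega$ if $\mathcal E_L(u,\varphi)=\int_\Omega g\varphi\,dx$ for every nonnegative $\varphi\in\mathbb H(\Omega)$. **Theorem.** Let $\Omega\subset\mathbb R^N$ be a bounded open set with Lipschitz boundary (not necessarily connected, and of arbitrary measure) which is convex in the direction $e_1$, that is, $\Omega$ contains every segment parallel to $e_1$ whose endpoints lie in $\Omega$, and symmetric with respect to the hyperplane $\{x_1=0\}$. Let $f:\mathbb R\to\mathbb R$ be locally Lipschitz, and let $u:\mathbb R^N\to\mathbb R$ with $u\in C(\overline\Omega)\cap\mathbb H(\Omega)$ and $u>0$ in $\Omega$ be a weak solution of $$L_\Delta u=f(u)\ \text{ in }\Omega,\qquad u=0\ \text{ in }\mathbb R^N\setminus\Omega,$$ where the exterior condition holds at every point of $\mathbb R^N\setminus\Omega$ (in particular on $\partial\Omega$). Then $u$ is symmetric with respect to $\{x_1=0\}$, that is, $u(-x_1,x')=u(x_1,x')$ for all $(x_1,x')\in\mathbb R\times\mathbb R^{N-1}$, and $u$ is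 strictly decreasing in the direction $e_1$ in $\Omega\cap\{x_1>0\}$: if $(s,x'),(t,x')\in\Omega$ and $0<s<t$, then $u(t,x')<u(s,x')$. -/

import Mathlib

open MeasureTheory Set Metric

/-- The constant `c_N = π^{-N/2} Γ(N/2)` of the logarithmic Laplacian on `ℝ^N`. -/
noncomputable def logLapC (N : ℕ) : ℝ :=
  Real.pi ^ (-((N : ℝ) / 2)) * Real.Gamma ((N : ℝ) / 2)

/-- The constant `ρ_N = 2 log 2 + ψ(N/2) - γ` of the logarithmic Laplacian on `ℝ^N`, where
`ψ = Γ'/Γ` is the digamma function and `γ` is the Euler–Mascheroni constant. -/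
noncomputable def logLapRho (N : ℕ) : ℝ :=
  2 * Real.log 2 + logDeriv Real.Gamma ((N : ℝ) / 2) - Real.eulerMascheroniConstant

/-- The kernel `k(z) = c_N |z|^{-N} 1_{B_1}(z)` (its value at `0` is irrelevant). -/
noncomputable def kernelK {N : ℕ} (z : EuclideanSpace ℝ (Fin N)) : ℝ :=
  (ball (0 : EuclideanSpace ℝ (Fin N)) 1).indicator (fun z => logLapC N / ‖z‖ ^ N) z

/-- The kernel `j(z) = c_N |z|^{-N} 1_{ℝ^N ∖ B_1}(z)`. -/
noncomputable def kernelJ {N : ℕ} (z : EuclideanSpace ℝ (Fin N)) : ℝ :=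
  (ball (0 : EuclideanSpace ℝ (Fin N)) 1)ᶜ.indicator (fun z => logLapC N / ‖z‖ ^ N) z

/-- The form `𝓔(u,v) = ½ ∬ (u(x) - u(y)) (v(x) - v(y)) k(x - y) dx dy`. -/
noncomputable def energyForm {N : ℕ} (u v : EuclideanSpace ℝ (Fin N) → ℝ) : ℝ :=
  1 / 2 * ∫ p : EuclideanSpace ℝ (Fin N) × EuclideanSpace ℝ (Fin N),
    (u p.1 - u p.2) * (v p.1 - v p.2) * kernelK (p.1 - p.2)

/-- `u ∈ ℍ(ℝ^N)`: `u ∈ L²(ℝ^N)` and `𝓔(u,u) < ∞`. The integrand of `𝓔(u,u)` is nonnegative and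
measurable, so that finiteness of `𝓔(u,u)` is integrability of that integrand. -/
structure MemHspace {N : ℕ} (u : EuclideanSpace ℝ (Fin N) → ℝ) : Prop where
  memLp : MemLp u 2 volume
  finite_energy : Integrable
    (fun p : EuclideanSpace ℝ (Fin N) × EuclideanSpace ℝ (Fin N) =>
      (u p.1 - u p.2) * (u p.1 - u p.2) * kernelK (p.1 - p.2)) volume

/-- `u ∈ ℍ(Ω)`: `u ∈ ℍ(ℝ^N)` and `u = 0` almost everywhere in the complement of `Ω`. -/
structure MemHspaceOn {N : ℕ} (Ω : Set (EuclideanSpace ℝ (Fin N)))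
    (u : EuclideanSpace ℝ (Fin N) → ℝ) : Prop where
  memHspace : MemHspace u
  ae_zero : ∀ᵐ x ∂(volume : Measure (EuclideanSpace ℝ (Fin N))), x ∉ Ω → u x = 0

/-- The bilinear form of the logarithmic Laplacian,
`𝓔_L(u,v) = 𝓔(u,v) - ∬ u(x) v(y) j(x - y) dx dy + ρ_N ∫ u v dx`. -/
noncomputable def logLapForm {N : ℕ} (u v : EuclideanSpace ℝ (Fin N) → ℝ) : ℝ :=
  energyForm u v
    - (∫ p : EuclideanSpace ℝ (Fin N) × EuclideanSpace ℝ (Fin N),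
        u p.1 * v p.2 * kernelJ (p.1 - p.2))
    + logLapRho N * ∫ x, u x * v x

/-- `L_Δ u ≥ g` in `Ω` in the weak sense, for `u ∈ ℍ(ℝ^N)` and right-hand sides `g ∈ L²(Ω)`
(for a continuous `u` on a bounded `closure Ω` and `g = f ∘ u` with `f` continuous, `g` is bounded
on `Ω` and therefore in `L²(Ω)`). -/
def IsWeakSupersolution {N : ℕ} (Ω : Set (EuclideanSpace ℝ (Fin N)))
    (g u : EuclideanSpace ℝ (Fin N) → ℝ) : Prop :=
  MemHspace u ∧ ∀ φ : EuclideanSpace ℝ (Fin N) → ℝ, MemHspaceOn Ω φ → (∀ x, 0 ≤ φ x) →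
    ∫ x in Ω, g x * φ x ≤ logLapForm u φ

/-- `L_Δ u ≤ g` in `Ω` in the weak sense. -/
def IsWeakSubsolution {N : ℕ} (Ω : Set (EuclideanSpace ℝ (Fin N)))
    (g u : EuclideanSpace ℝ (Fin N) → ℝ) : Prop :=
  MemHspace u ∧ ∀ φ : EuclideanSpace ℝ (Fin N) → ℝ, MemHspaceOn Ω φ → (∀ x, 0 ≤ φ x) →
    logLapForm u φ ≤ ∫ x in Ω, g x * φ x

/-- `L_Δ u = g` in `Ω` in the weak sense. -/
def IsWeakSolution {N : ℕ} (Ω : Set (EuclideanSpace ℝ (Fin N)))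
    (g u : EuclideanSpace ℝ (Fin N) → ℝ) : Prop :=
  IsWeakSupersolution Ω g u ∧ IsWeakSubsolution Ω g u

/-- `Ω` has Lipschitz boundary: near each boundary point, and up to a choice of the vertical
direction `ν`, the set `Ω` is the region strictly above the graph of a Lipschitz function of the
orthogonal (horizontal) variables. -/
def HasLipschitzBoundary {N : ℕ} (Ω : Set (EuclideanSpace ℝ (Fin N))) : Prop :=
  ∀ p ∈ frontier Ω, ∃ (ν : EuclideanSpace ℝ (Fin N)) (ψ : (ℝ ∙ ν)ᗮ → ℝ) (K : NNReal) (r : ℝ),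
    ‖ν‖ = 1 ∧ LipschitzWith K ψ ∧ 0 < r ∧
      ∀ x ∈ ball p r, x ∈ Ω ↔ ψ ((ℝ ∙ ν)ᗮ.orthogonalProjectionOnto x) < inner ℝ ν x

/-- The first coordinate vector `e₁`. -/
noncomputable def e1 (N : ℕ) [NeZero N] : EuclideanSpace ℝ (Fin N) :=
  EuclideanSpace.single 0 1

/-- `Ω` is convex in the direction `e`: it contains every segment parallel to `e` whose endpoints
lie in `Ω`. -/
def ConvexInDirection {N : ℕ} (e : EuclideanSpace ℝ (Fin N))
    (Ω : Set (EuclideanSpace ℝ (Fin N))) : Prop :=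
  ∀ x ∈ Ω, ∀ t : ℝ, x + t • e ∈ Ω → segment ℝ x (x + t • e) ⊆ Ω

/-- The reflection `(x₁, x') ↦ (-x₁, x')` about the hyperplane `{x₁ = 0}`. -/
noncomputable def reflectFirst {N : ℕ} [NeZero N] (x : EuclideanSpace ℝ (Fin N)) :
    EuclideanSpace ℝ (Fin N) :=
  x - (2 * x 0) • e1 N

/-!
The proof is the method of moving planes. For `l > 0` let `R` be the reflection about `{x₁ = l}`, let
`H = {x₁ ≥ l}`, and let `w = u - u ∘ R`, which is antisymmetric under `R` and satisfies
`w ≤ 0` in `H ∖ Ω`. By the equation for `u` and the symmetries of the form, `w` solves a linear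
equation with bounded coefficient in `Ω ∩ H`. The goal is `w < 0` in `Ω ∩ {x₁ > l}` for all `l > 0`;
this is the monotonicity, and the symmetry follows by letting `l → 0` for `u` and for its reflection
about `{x₁ = 0}`.

Everything rests on testing an antisymmetric `h` with `φ = 1_H h⁺` (`posHalf`). For `x, y ∈ H` one has
`|x - y| ≤ |Rx - y|`, and both `k` and `k + j` are radially decreasing, although `j` alone is not.
Summing integrands over the four pairs obtained from `(x, y)` by reflecting each point
(`orbitSum`) turns the needed inequalities into pointwise ones for `x, y ∈ H`. In this way `φ` has
finite energy (`Admissible.posHalf`), and `𝓔_L(h, φ) ≥ 𝓔_L(φ, φ)`, with a gain proportional to `∫ φ`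
if `h` is negative on some set of positive measure (`logLapForm_posHalf_add_le`).

Two maximum principles follow.
* In sets of small measure: `𝓔_L(φ, φ) ≥ K ‖φ‖²` if the support of `φ` is small enough, because
  `|z|^{-N}` is not integrable at the origin (`exists_measure_le_logLapForm_self`). With `h = w` this
  gives `w ≤ 0` once `{w > 0} ∩ Ω ∩ H` has small measure
  (`MovingPlaneData.exists_measure_le_reflect`).
* The strong maximum principle: if `w ≤ 0` in `H` and `l > 0`, then `w < 0` in the interior of
  `Ω ∩ H` (`MovingPlaneData.lt_reflectAt`). Here `h = ε g + w` with an antisymmetrized tent `g` at a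
  supposed zero of `w`. The far left part of `Ω` is reflected to a region in which `w` is negative
  by a definite amount, and for small `ε` the resulting gain beats the error `ε 𝓔_L(g, φ)`.

The strict inequality at the infimal position `s > 0` of the plane and dominated convergence make the
set where the inequality fails small for positions slightly to the left of `s`; hence there is no
such `s` (`MovingPlaneData.le_reflectAt`). No smallness of `Ω` and no connectedness is needed.
-/

/-! ### Reflections at hyperplanes orthogonal to `e₁` -/

section Reflection

variable {N : ℕ} [NeZero N]

/-- The reflection about the hyperplane `{x₁ = l}`. -/
noncomputable def reflectAt (l : ℝ) (x : EuclideanSpace ℝ (Fin N)) : EuclideanSpace ℝ (Fin N) :=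
  x - (2 * (x 0 - l)) • e1 N

lemma e1_apply_zero : e1 N 0 = 1 := by simp [e1]

lemma norm_e1 : ‖e1 N‖ = 1 := by simp [e1]

lemma reflectAt_apply_zero (l : ℝ) (x : EuclideanSpace ℝ (Fin N)) :
    reflectAt l x 0 = 2 * l - x 0 := by
  simp [reflectAt, e1_apply_zero]; ring

lemma reflectAt_zero (x : EuclideanSpace ℝ (Fin N)) : reflectAt 0 x = reflectFirst x := by
  simp [reflectAt, reflectFirst]

@[simp] lemma reflectAt_reflectAt (l : ℝ) (x : EuclideanSpace ℝ (Fin N)) :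
    reflectAt l (reflectAt l x) = x := by
  rw [reflectAt, reflectAt_apply_zero, reflectAt, sub_sub, ← add_smul]
  ring_nf
  simp

lemma inner_e1 (z : EuclideanSpace ℝ (Fin N)) : inner ℝ z (e1 N) = z 0 := by
  simp [e1, EuclideanSpace.inner_single_right]

lemma norm_sub_smul_e1_sq (z : EuclideanSpace ℝ (Fin N)) (t : ℝ) :
    ‖z - t • e1 N‖ ^ 2 = ‖z‖ ^ 2 - 2 * t * z 0 + t ^ 2 := by
  rw [norm_sub_sq_real, inner_smul_right, inner_e1, norm_smul, norm_e1]
  simp; ring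

lemma norm_reflectAt_sub_reflectAt (l : ℝ) (x y : EuclideanSpace ℝ (Fin N)) :
    ‖reflectAt l x - reflectAt l y‖ = ‖x - y‖ := by
  have h : reflectAt l x - reflectAt l y = (x - y) - (2 * (x - y) 0) • e1 N := by
    simp only [reflectAt, PiLp.sub_apply]
    module
  rw [← sq_eq_sq₀ (norm_nonneg _) (norm_nonneg _), h, norm_sub_smul_e1_sq]
  ring

lemma norm_reflectAt_sub (l : ℝ) (x y : EuclideanSpace ℝ (Fin N)) :
    ‖reflectAt l x - y‖ = ‖x - reflectAt l y‖ := by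
  rw [← norm_reflectAt_sub_reflectAt l, reflectAt_reflectAt]

lemma norm_reflectAt_sub_sq (l : ℝ) (x y : EuclideanSpace ℝ (Fin N)) :
    ‖reflectAt l x - y‖ ^ 2 = ‖x - y‖ ^ 2 + 4 * (x 0 - l) * (y 0 - l) := by
  have h : reflectAt l x - y = (x - y) - (2 * (x 0 - l)) • e1 N := by
    simp only [reflectAt]; module
  rw [h, norm_sub_smul_e1_sq, PiLp.sub_apply]
  ring

lemma norm_sub_le_norm_reflectAt_sub {l : ℝ} {x y : EuclideanSpace ℝ (Fin N)}
    (hx : l ≤ x 0) (hy : l ≤ y 0) : ‖x - y‖ ≤ ‖reflectAt l x - y‖ := by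
  rw [← sq_le_sq₀ (norm_nonneg _) (norm_nonneg _), norm_reflectAt_sub_sq]
  nlinarith [mul_nonneg (sub_nonneg.2 hx) (sub_nonneg.2 hy)]

lemma isometry_reflectAt (l : ℝ) : Isometry (reflectAt (N := N) l) :=
  Isometry.of_dist_eq fun x y => by
    rw [dist_eq_norm, dist_eq_norm, norm_reflectAt_sub_reflectAt]

lemma continuous_reflectAt (l : ℝ) : Continuous (reflectAt (N := N) l) :=
  (isometry_reflectAt l).continuous

/-- The reflection about `{x₁ = l}` as a measurable equivalence. -/
noncomputable def reflectEquiv (N : ℕ) [NeZero N] (l : ℝ) :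
    EuclideanSpace ℝ (Fin N) ≃ᵐ EuclideanSpace ℝ (Fin N) where
  toFun := reflectAt l
  invFun := reflectAt l
  left_inv := reflectAt_reflectAt l
  right_inv := reflectAt_reflectAt l
  measurable_toFun := (continuous_reflectAt l).measurable
  measurable_invFun := (continuous_reflectAt l).measurable

@[simp] lemma reflectEquiv_apply (l : ℝ) (x : EuclideanSpace ℝ (Fin N)) :
    reflectEquiv N l x = reflectAt l x := rfl

lemma measurePreserving_reflectEquiv (l : ℝ) :
    MeasurePreserving (reflectEquiv N l) volume volume := by
  have h0 : MeasurePreserving (fun x : EuclideanSpace ℝ (Fin N) =>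
      (ℝ ∙ e1 N)ᗮ.reflection x + (2 * l) • e1 N) volume volume :=
    (measurePreserving_add_right volume _).comp
      ((ℝ ∙ e1 N)ᗮ.reflection).measurePreserving
  convert h0 using 1
  ext1 x
  rw [Submodule.reflection_orthogonal_apply, Submodule.reflection_singleton_apply]
  rw [real_inner_comm, inner_e1, norm_e1]
  simp only [reflectEquiv_apply, reflectAt]
  simp
  module

/-- Reflection of the first variable of a pair. -/
noncomputable def reflectLeft (N : ℕ) [NeZero N] (l : ℝ) :
    EuclideanSpace ℝ (Fin N) × EuclideanSpace ℝ (Fin N) ≃ᵐ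
      EuclideanSpace ℝ (Fin N) × EuclideanSpace ℝ (Fin N) :=
  (reflectEquiv N l).prodCongr (MeasurableEquiv.refl _)

/-- Reflection of the second variable of a pair. -/
noncomputable def reflectRight (N : ℕ) [NeZero N] (l : ℝ) :
    EuclideanSpace ℝ (Fin N) × EuclideanSpace ℝ (Fin N) ≃ᵐ
      EuclideanSpace ℝ (Fin N) × EuclideanSpace ℝ (Fin N) :=
  (MeasurableEquiv.refl _).prodCongr (reflectEquiv N l)

@[simp] lemma reflectLeft_apply (l : ℝ)
    (p : EuclideanSpace ℝ (Fin N) × EuclideanSpace ℝ (Fin N)) :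
    reflectLeft N l p = (reflectAt l p.1, p.2) := rfl

@[simp] lemma reflectRight_apply (l : ℝ)
    (p : EuclideanSpace ℝ (Fin N) × EuclideanSpace ℝ (Fin N)) :
    reflectRight N l p = (p.1, reflectAt l p.2) := rfl

lemma measurePreserving_reflectLeft (l : ℝ) :
    MeasurePreserving (reflectLeft N l) volume volume :=
  (measurePreserving_reflectEquiv l).prod (MeasurePreserving.id _)

lemma measurePreserving_reflectRight (l : ℝ) :
    MeasurePreserving (reflectRight N l) volume volume :=
  (MeasurePreserving.id _).prod (measurePreserving_reflectEquiv l)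

/-- The sum of a function of two points over the orbit of the group generated by the reflections of
either variable. -/
noncomputable def orbitSum (l : ℝ)
    (F : EuclideanSpace ℝ (Fin N) × EuclideanSpace ℝ (Fin N) → ℝ)
    (p : EuclideanSpace ℝ (Fin N) × EuclideanSpace ℝ (Fin N)) : ℝ :=
  F p + F (reflectAt l p.1, p.2) + F (p.1, reflectAt l p.2)
    + F (reflectAt l p.1, reflectAt l p.2)

lemma integrable_orbitSum {l : ℝ}
    {F : EuclideanSpace ℝ (Fin N) × EuclideanSpace ℝ (Fin N) → ℝ} (hF : Integrable F volume) :
    Integrable (orbitSum l F) volume := by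
  have h1 := (measurePreserving_reflectLeft (N := N) l).integrable_comp_of_integrable hF
  have h2 := (measurePreserving_reflectRight (N := N) l).integrable_comp_of_integrable hF
  have h3 := (measurePreserving_reflectRight (N := N) l).integrable_comp_of_integrable h1
  exact ((hF.add h1).add h2).add h3

lemma integral_orbitSum {l : ℝ}
    {F : EuclideanSpace ℝ (Fin N) × EuclideanSpace ℝ (Fin N) → ℝ} (hF : Integrable F volume) :
    ∫ p, orbitSum l F p = 4 * ∫ p, F p := by
  have h1 := (measurePreserving_reflectLeft (N := N) l).integrable_comp_of_integrable hF
  have h2 := (measurePreserving_reflectRight (N := N) l).integrable_comp_of_integrable hF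
  have h3 := (measurePreserving_reflectRight (N := N) l).integrable_comp_of_integrable h1
  have e1 := (measurePreserving_reflectLeft (N := N) l).integral_comp' F
  have e2 := (measurePreserving_reflectRight (N := N) l).integral_comp' F
  have e3 := (measurePreserving_reflectRight (N := N) l).integral_comp' (F ∘ reflectLeft N l)
  have : ∫ p, orbitSum l F p = ∫ p, (F + F ∘ reflectLeft N l + F ∘ reflectRight N l
      + (F ∘ reflectLeft N l) ∘ reflectRight N l) p := rfl
  rw [this, integral_add' ((hF.add h1).add h2) h3, integral_add' (hF.add h1) h2,
    integral_add' hF h1]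
  simp only [Function.comp_apply] at e1 e2 e3 ⊢
  rw [e1, e2, e3, e1]
  ring

/-- An orbit sum is invariant under both reflections, so that bounds for it need only be checked
for pairs of points in the half-space `{x₁ ≥ l}`. -/
lemma forall_orbitSum_le {l : ℝ}
    {F G : EuclideanSpace ℝ (Fin N) × EuclideanSpace ℝ (Fin N) → ℝ}
    (h : ∀ x y : EuclideanSpace ℝ (Fin N), l ≤ x 0 → l ≤ y 0 →
      orbitSum l F (x, y) ≤ orbitSum l G (x, y)) (p) : orbitSum l F p ≤ orbitSum l G p := by
  obtain ⟨x, y⟩ := p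
  have hr : ∀ z : EuclideanSpace ℝ (Fin N), l ≤ z 0 ∨ l ≤ reflectAt l z 0 := fun z => by
    rw [reflectAt_apply_zero]
    rcases le_total l (z 0) with h | h
    · exact Or.inl h
    · right; linarith
  rcases hr x with hx | hx <;> rcases hr y with hy | hy
  · exact h x y hx hy
  · have := h x _ hx hy
    simp only [orbitSum, reflectAt_reflectAt] at this ⊢
    linarith
  · have := h _ y hx hy
    simp only [orbitSum, reflectAt_reflectAt] at this ⊢
    linarith
  · have := h _ _ hx hy
    simp only [orbitSum, reflectAt_reflectAt] at this ⊢
    linarith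

end Reflection

/-! ### The kernels -/

section Kernels

variable {N : ℕ}

/-- The kernel `k + j = c_N |z|^{-N}`. -/
noncomputable def fullKernel (z : EuclideanSpace ℝ (Fin N)) : ℝ := logLapC N / ‖z‖ ^ N

lemma kernelK_add_kernelJ (z : EuclideanSpace ℝ (Fin N)) :
    kernelK z + kernelJ z = fullKernel z := by
  rw [kernelK, kernelJ, ← Pi.add_apply, indicator_self_add_compl]
  rfl

lemma kernelK_eq (z : EuclideanSpace ℝ (Fin N)) :
    kernelK z = if ‖z‖ < 1 then logLapC N / ‖z‖ ^ N else 0 := by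
  by_cases h : ‖z‖ < 1
  · rw [kernelK, indicator_of_mem (mem_ball_zero_iff.2 h), if_pos h]
  · rw [kernelK, indicator_of_notMem (fun h' => h (mem_ball_zero_iff.1 h')), if_neg h]

lemma kernelJ_eq (z : EuclideanSpace ℝ (Fin N)) :
    kernelJ z = if ‖z‖ < 1 then 0 else logLapC N / ‖z‖ ^ N := by
  by_cases h : ‖z‖ < 1
  · rw [kernelJ, indicator_of_notMem (not_not.2 (mem_ball_zero_iff.2 h)), if_pos h]
  · rw [kernelJ, indicator_of_mem (mt mem_ball_zero_iff.1 h), if_neg h]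

lemma kernelK_congr {z z' : EuclideanSpace ℝ (Fin N)} (h : ‖z‖ = ‖z'‖) :
    kernelK z = kernelK z' := by
  rw [kernelK_eq, kernelK_eq, h]

lemma kernelJ_congr {z z' : EuclideanSpace ℝ (Fin N)} (h : ‖z‖ = ‖z'‖) :
    kernelJ z = kernelJ z' := by
  rw [kernelJ_eq, kernelJ_eq, h]

lemma fullKernel_congr {z z' : EuclideanSpace ℝ (Fin N)} (h : ‖z‖ = ‖z'‖) :
    fullKernel z = fullKernel z' := by
  rw [fullKernel, fullKernel, h]

@[fun_prop]
lemma measurable_kernelK : Measurable (kernelK (N := N)) :=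
  (measurable_const.div (measurable_norm.pow_const _)).indicator measurableSet_ball

@[fun_prop]
lemma measurable_kernelJ : Measurable (kernelJ (N := N)) :=
  (measurable_const.div (measurable_norm.pow_const _)).indicator measurableSet_ball.compl

lemma measurableSet_le_norm (ε : ℝ) :
    MeasurableSet {z : EuclideanSpace ℝ (Fin N) | ε ≤ ‖z‖} :=
  measurableSet_le measurable_const measurable_norm

/-- The function `(x, y) ↦ a(y) m(x - y)` is integrable for integrable `a` and `m`. -/
lemma integrable_mul_comp_sub {a m : EuclideanSpace ℝ (Fin N) → ℝ}
    (ha : Integrable a volume) (hm : Integrable m volume) :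
    Integrable (fun p : EuclideanSpace ℝ (Fin N) × EuclideanSpace ℝ (Fin N) =>
      a p.2 * m (p.1 - p.2)) volume :=
  ha.convolution_integrand (ContinuousLinearMap.mul ℝ ℝ) hm

lemma integral_mul_comp_sub {a m : EuclideanSpace ℝ (Fin N) → ℝ}
    (ha : Integrable a volume) (hm : Integrable m volume) :
    ∫ p : EuclideanSpace ℝ (Fin N) × EuclideanSpace ℝ (Fin N), a p.2 * m (p.1 - p.2) =
      (∫ x, a x) * ∫ z, m z := by
  have h := integrable_mul_comp_sub ha hm
  rw [Measure.volume_eq_prod] at h ⊢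
  rw [integral_prod_symm _ h]
  simp only [integral_const_mul, integral_sub_right_eq_self (fun z => m z), integral_mul_const]

lemma integral_comp_swap (F : EuclideanSpace ℝ (Fin N) × EuclideanSpace ℝ (Fin N) → ℝ) :
    ∫ p : EuclideanSpace ℝ (Fin N) × EuclideanSpace ℝ (Fin N), F (p.2, p.1) = ∫ p, F p :=
  (Measure.measurePreserving_swap (μ := (volume : Measure (EuclideanSpace ℝ (Fin N))))
    (ν := (volume : Measure (EuclideanSpace ℝ (Fin N))))).integral_comp'
    (f := MeasurableEquiv.prodComm) F

lemma integrable_comp_swap {F : EuclideanSpace ℝ (Fin N) × EuclideanSpace ℝ (Fin N) → ℝ}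
    (hF : Integrable F volume) :
    Integrable (fun p : EuclideanSpace ℝ (Fin N) × EuclideanSpace ℝ (Fin N) => F (p.2, p.1))
      volume :=
  hF.swap

/-- The bounded kernel `k` restricted to `{|z| ≥ ε}`. -/
noncomputable def truncKernel (ε : ℝ) (z : EuclideanSpace ℝ (Fin N)) : ℝ :=
  {z : EuclideanSpace ℝ (Fin N) | ε ≤ ‖z‖}.indicator kernelK z

@[fun_prop]
lemma measurable_truncKernel (ε : ℝ) : Measurable (truncKernel (N := N) ε) :=
  measurable_kernelK.indicator (measurableSet_le_norm ε)

variable [NeZero N]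

variable (N) in
lemma logLapC_pos : 0 < logLapC N :=
  mul_pos (Real.rpow_pos_of_pos Real.pi_pos _)
    (Real.Gamma_pos_of_pos (by have := NeZero.pos N; positivity))

lemma kernelK_nonneg (z : EuclideanSpace ℝ (Fin N)) : 0 ≤ kernelK z := by
  have := logLapC_pos N
  rw [kernelK_eq]; positivity

lemma kernelJ_nonneg (z : EuclideanSpace ℝ (Fin N)) : 0 ≤ kernelJ z := by
  have := logLapC_pos N
  rw [kernelJ_eq]; positivity

lemma fullKernel_nonneg (z : EuclideanSpace ℝ (Fin N)) : 0 ≤ fullKernel z := by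
  have := logLapC_pos N
  rw [fullKernel]; positivity

lemma kernelJ_le (z : EuclideanSpace ℝ (Fin N)) : kernelJ z ≤ logLapC N := by
  have := logLapC_pos N
  rw [kernelJ_eq]
  split_ifs with h
  · exact this.le
  · exact div_le_self this.le (one_le_pow₀ (not_lt.1 h))

/-- In Lean `k` and `k + j` are zero at the origin, by the convention for division by zero; away from
it they are radially decreasing. -/
lemma kernelK_anti {z z' : EuclideanSpace ℝ (Fin N)} (h0 : z ≠ 0) (h : ‖z‖ ≤ ‖z'‖) :
    kernelK z' ≤ kernelK z := by
  have := logLapC_pos N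
  have h0' := norm_pos_iff.2 h0
  rw [kernelK_eq, kernelK_eq]
  split_ifs with h1 h2
  · gcongr
  · exact absurd (h.trans_lt h1) h2
  · positivity
  · exact le_rfl

lemma fullKernel_anti {z z' : EuclideanSpace ℝ (Fin N)} (h0 : z ≠ 0) (h : ‖z‖ ≤ ‖z'‖) :
    fullKernel z' ≤ fullKernel z := by
  have := logLapC_pos N
  have h0' := norm_pos_iff.2 h0
  rw [fullKernel, fullKernel]
  gcongr

variable (N) in
lemma nontrivial_euclideanSpace : Nontrivial (EuclideanSpace ℝ (Fin N)) :=
  ⟨e1 N, 0, by rw [← norm_ne_zero_iff, norm_e1]; exact one_ne_zero⟩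

lemma integrable_norm_mul_kernelK :
    Integrable (fun z : EuclideanSpace ℝ (Fin N) => ‖z‖ * kernelK z) volume := by
  have hN : N - 1 + 1 = N := Nat.sub_add_cancel (NeZero.pos N)
  have key : Integrable (fun z : EuclideanSpace ℝ (Fin N) =>
      (fun y : ℝ => y * if y < 1 then logLapC N / y ^ N else 0) ‖z‖) volume := by
    have := nontrivial_euclideanSpace N
    rw [integrable_fun_norm_addHaar volume
      (f := fun y : ℝ => y * if y < 1 then logLapC N / y ^ N else 0),
      finrank_euclideanSpace_fin]
    have h1 : IntegrableOn ((Iio (1 : ℝ)).indicator fun _ => logLapC N) (Ioi 0) volume := by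
      rw [IntegrableOn, integrable_indicator_iff measurableSet_Iio, IntegrableOn,
        Measure.restrict_restrict measurableSet_Iio]
      refine integrableOn_const ?_
      rw [inter_comm, Ioi_inter_Iio]; simp
    refine h1.congr_fun (fun y hy => ?_) measurableSet_Ioi
    have hy0 : y ≠ 0 := ne_of_gt hy
    simp only [indicator_apply, mem_Iio, smul_eq_mul]
    split_ifs
    · have : y ^ N = y ^ (N - 1) * y := by rw [← pow_succ, hN]
      rw [this]; field_simp
    · simp
  simpa only [kernelK_eq] using key

lemma not_integrable_kernelK :
    ¬ Integrable (kernelK (N := N)) volume := by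
  have hN : N - 1 + 1 = N := Nat.sub_add_cancel (NeZero.pos N)
  intro h
  have h' : Integrable (fun z : EuclideanSpace ℝ (Fin N) =>
      (fun y : ℝ => if y < 1 then logLapC N / y ^ N else 0) ‖z‖) volume := by
    refine h.congr (Filter.Eventually.of_forall fun z => ?_)
    simp only [kernelK_eq]
  have := nontrivial_euclideanSpace N
  rw [integrable_fun_norm_addHaar volume
    (f := fun y : ℝ => if y < 1 then logLapC N / y ^ N else 0),
    finrank_euclideanSpace_fin] at h'
  have h2 : IntegrableOn (fun y : ℝ => y⁻¹) (Ioo 0 1) volume := by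
    have h3 : IntegrableOn (fun y : ℝ => (logLapC N)⁻¹ *
        (y ^ (N - 1) • if y < 1 then logLapC N / y ^ N else 0)) (Ioo 0 1) volume :=
      (h'.mono_set fun y (hy : y ∈ Ioo (0 : ℝ) 1) => hy.1).const_mul _
    refine h3.congr_fun (fun y hy => ?_) measurableSet_Ioo
    have hy0 : y ≠ 0 := ne_of_gt hy.1
    have hc := (logLapC_pos N).ne'
    have : y ^ N = y ^ (N - 1) * y := by rw [← pow_succ, hN]
    simp only [smul_eq_mul, if_pos hy.2, this]
    field_simp
  have h4 : IntervalIntegrable (fun y : ℝ => y⁻¹) volume 0 1 := by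
    rwa [intervalIntegrable_iff_integrableOn_Ioo_of_le zero_le_one]
  rw [intervalIntegrable_inv_iff] at h4
  simp at h4

lemma truncKernel_nonneg (ε : ℝ) (z : EuclideanSpace ℝ (Fin N)) : 0 ≤ truncKernel ε z :=
  indicator_nonneg (fun _ _ => kernelK_nonneg _) _

lemma truncKernel_le_kernelK (ε : ℝ) (z : EuclideanSpace ℝ (Fin N)) :
    truncKernel ε z ≤ kernelK z :=
  indicator_le_self' (fun _ _ => kernelK_nonneg _) _

lemma truncKernel_le {ε : ℝ} (hε : 0 < ε) (z : EuclideanSpace ℝ (Fin N)) :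
    truncKernel ε z ≤ logLapC N / ε ^ N := by
  have := logLapC_pos N
  simp only [truncKernel, indicator_apply, mem_ofPred_eq, kernelK_eq]
  split_ifs with h1 h2
  · gcongr
  all_goals positivity

lemma integrable_truncKernel {ε : ℝ} (hε : 0 < ε) :
    Integrable (truncKernel (N := N) ε) volume := by
  have h : Integrable ((ball (0 : EuclideanSpace ℝ (Fin N)) 1).indicator
      fun _ => logLapC N / ε ^ N) volume :=
    (integrable_indicator_iff measurableSet_ball).2
      (integrableOn_const measure_ball_lt_top.ne)
  refine h.mono' (measurable_truncKernel ε).aestronglyMeasurable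
    (Filter.Eventually.of_forall fun z => ?_)
  rw [Real.norm_of_nonneg (truncKernel_nonneg ε z)]
  by_cases h1 : z ∈ ball (0 : EuclideanSpace ℝ (Fin N)) 1
  · rw [indicator_of_mem h1]
    exact truncKernel_le hε z
  · refine (truncKernel_le_kernelK ε z).trans ?_
    rw [kernelK_eq, if_neg (fun h => h1 (mem_ball_zero_iff.2 h)), indicator_of_notMem h1]

/-- The mass of the truncated kernels is unbounded, because `|z|^{-N}` is not integrable at the
origin. -/
lemma exists_le_integral_truncKernel (N : ℕ) [NeZero N] (C : ℝ) :
    ∃ ε > 0, C ≤ ∫ z : EuclideanSpace ℝ (Fin N), truncKernel ε z := by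
  by_contra! hcon
  have hpos : ∀ n : ℕ, (0 : ℝ) < 1 / ((n : ℝ) + 1) := fun n => by positivity
  have hcover : AECover (volume : Measure (EuclideanSpace ℝ (Fin N))) Filter.atTop
      (fun n : ℕ => {z : EuclideanSpace ℝ (Fin N) | 1 / ((n : ℝ) + 1) ≤ ‖z‖}) := by
    refine ⟨?_, fun n => measurableSet_le_norm _⟩
    have h0 : ∀ᵐ z : EuclideanSpace ℝ (Fin N), z ≠ 0 := by
      have := nontrivial_euclideanSpace N
      simp [ae_iff]
    filter_upwards [h0] with z hz
    exact (tendsto_one_div_add_atTop_nhds_zero_nat.eventually_lt_const (norm_pos_iff.2 hz)).mono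
      fun n hn => hn.le
  refine not_integrable_kernelK (N := N)
    (hcover.integrable_of_integral_bounded_of_nonneg_ae C (fun n => ?_)
      (Filter.Eventually.of_forall kernelK_nonneg) (Filter.Eventually.of_forall fun n => ?_))
  · exact (integrable_indicator_iff (measurableSet_le_norm _)).1 (integrable_truncKernel (hpos n))
  · rw [← integral_indicator (measurableSet_le_norm _)]
    exact (hcon _ (hpos n)).le

end Kernels

/-! ### Bounded functions of finite energy with bounded support -/

section Admissible

variable {N : ℕ}

/-- The integrand of the form `𝓔(u,v)`. -/
noncomputable def energyDensity (u v : EuclideanSpace ℝ (Fin N) → ℝ)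
    (p : EuclideanSpace ℝ (Fin N) × EuclideanSpace ℝ (Fin N)) : ℝ :=
  (u p.1 - u p.2) * (v p.1 - v p.2) * kernelK (p.1 - p.2)

/-- Bounded measurable functions with bounded support and finite energy. All functions to which
the form is applied are of this kind, and on them every integral in its definition converges
absolutely. -/
structure Admissible (u : EuclideanSpace ℝ (Fin N) → ℝ) : Prop where
  measurable : Measurable u
  bounded : ∃ M, ∀ x, |u x| ≤ M
  support : ∃ r, ∀ x, u x ≠ 0 → x ∈ ball (0 : EuclideanSpace ℝ (Fin N)) r
  energy : Integrable (energyDensity u u) volume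

lemma measurable_energyDensity {u v : EuclideanSpace ℝ (Fin N) → ℝ} (hu : Measurable u)
    (hv : Measurable v) : Measurable (energyDensity u v) := by
  unfold energyDensity
  fun_prop

/-- A bounded measurable function with bounded support is integrable. -/
lemma integrable_of_bounded_support {u : EuclideanSpace ℝ (Fin N) → ℝ} (hu : Measurable u)
    {M r : ℝ} (hM : ∀ x, |u x| ≤ M)
    (hr : ∀ x, u x ≠ 0 → x ∈ ball (0 : EuclideanSpace ℝ (Fin N)) r) : Integrable u volume := by
  have h : Integrable ((ball (0 : EuclideanSpace ℝ (Fin N)) r).indicator fun _ => M) volume :=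
    (integrable_indicator_iff measurableSet_ball).2 (integrableOn_const measure_ball_lt_top.ne)
  refine h.mono' hu.aestronglyMeasurable (Filter.Eventually.of_forall fun x => ?_)
  by_cases hx : x ∈ ball (0 : EuclideanSpace ℝ (Fin N)) r
  · rw [indicator_of_mem hx]; exact hM x
  · rw [indicator_of_notMem hx, not_imp_comm.1 (hr x) hx, norm_zero]

lemma energyDensity_self_nonneg [NeZero N] (u : EuclideanSpace ℝ (Fin N) → ℝ)
    (p : EuclideanSpace ℝ (Fin N) × EuclideanSpace ℝ (Fin N)) : 0 ≤ energyDensity u u p :=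
  mul_nonneg (mul_self_nonneg _) (kernelK_nonneg _)

namespace Admissible

variable {u v : EuclideanSpace ℝ (Fin N) → ℝ}

lemma integrable (hu : Admissible u) : Integrable u volume := by
  obtain ⟨M, hM⟩ := hu.bounded
  obtain ⟨r, hr⟩ := hu.support
  exact integrable_of_bounded_support hu.measurable hM hr

lemma integrable_mul (hu : Admissible u) (hv : Admissible v) :
    Integrable (fun x => u x * v x) volume := by
  obtain ⟨M, hM⟩ := hu.bounded
  exact hv.integrable.bdd_mul hu.measurable.aestronglyMeasurable
    (Filter.Eventually.of_forall hM)

lemma memHspace (hu : Admissible u) : MemHspace u := by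
  refine ⟨?_, hu.energy⟩
  rw [memLp_two_iff_integrable_sq hu.measurable.aestronglyMeasurable]
  simpa only [sq] using hu.integrable_mul hu

lemma const_mul (hu : Admissible u) (c : ℝ) : Admissible (fun x => c * u x) := by
  obtain ⟨M, hM⟩ := hu.bounded
  obtain ⟨r, hr⟩ := hu.support
  refine ⟨hu.measurable.const_mul c, ⟨|c| * M, fun x => ?_⟩,
    ⟨r, fun x hx => hr x (right_ne_zero_of_mul hx)⟩, ?_⟩
  · rw [abs_mul]
    exact mul_le_mul_of_nonneg_left (hM x) (abs_nonneg c)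
  · refine (hu.energy.const_mul (c ^ 2)).congr (Filter.Eventually.of_forall fun p => ?_)
    simp only [energyDensity]
    ring

variable [NeZero N]

lemma sub (hu : Admissible u) (hv : Admissible v) : Admissible (fun x => u x - v x) := by
  obtain ⟨M, hM⟩ := hu.bounded
  obtain ⟨r, hr⟩ := hu.support
  obtain ⟨M', hM'⟩ := hv.bounded
  obtain ⟨r', hr'⟩ := hv.support
  have hm := hu.measurable.sub hv.measurable
  refine ⟨hm, ⟨M + M', fun x => (abs_sub _ _).trans (add_le_add (hM x) (hM' x))⟩,
    ⟨max r r', fun x hx => ?_⟩, ?_⟩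
  · by_cases h : u x = 0
    · exact ball_subset_ball (le_max_right _ _) (hr' x fun h' => hx (by simp [h, h']))
    · exact ball_subset_ball (le_max_left _ _) (hr x h)
  · refine ((hu.energy.add hv.energy).const_mul 2).mono'
      (measurable_energyDensity hm hm).aestronglyMeasurable
      (Filter.Eventually.of_forall fun p => ?_)
    rw [Real.norm_of_nonneg (energyDensity_self_nonneg _ p)]
    simp only [Pi.add_apply, energyDensity]
    nlinarith [mul_nonneg (kernelK_nonneg (p.1 - p.2))
      (sq_nonneg ((u p.1 - u p.2) + (v p.1 - v p.2)))]

lemma integrable_energyDensity (hu : Admissible u) (hv : Admissible v) :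
    Integrable (energyDensity u v) volume := by
  refine (hu.energy.add hv.energy).mono'
    (measurable_energyDensity hu.measurable hv.measurable).aestronglyMeasurable
    (Filter.Eventually.of_forall fun p => ?_)
  have hk := kernelK_nonneg (p.1 - p.2)
  simp only [Pi.add_apply, energyDensity]
  rw [Real.norm_eq_abs, abs_mul, abs_of_nonneg hk, ← add_mul]
  refine mul_le_mul_of_nonneg_right ?_ hk
  rw [abs_le]
  constructor <;> nlinarith [sq_nonneg ((u p.1 - u p.2) + (v p.1 - v p.2)),
    sq_nonneg ((u p.1 - u p.2) - (v p.1 - v p.2)), sq_nonneg (u p.1 - u p.2),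
    sq_nonneg (v p.1 - v p.2)]

lemma integrable_tail (hu : Admissible u) (hv : Admissible v) :
    Integrable (fun p : EuclideanSpace ℝ (Fin N) × EuclideanSpace ℝ (Fin N) =>
      u p.1 * v p.2 * kernelJ (p.1 - p.2)) volume := by
  refine (hu.integrable.mul_prod hv.integrable).mul_bdd (c := logLapC N)
    (Measurable.aestronglyMeasurable (by fun_prop)) (Filter.Eventually.of_forall fun p => ?_)
  rw [Real.norm_of_nonneg (kernelJ_nonneg _)]
  exact kernelJ_le _

lemma comp_reflectAt (hu : Admissible u) (l : ℝ) : Admissible (fun x => u (reflectAt l x)) := by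
  obtain ⟨M, hM⟩ := hu.bounded
  obtain ⟨r, hr⟩ := hu.support
  refine ⟨hu.measurable.comp (continuous_reflectAt l).measurable, ⟨M, fun x => hM _⟩,
    ⟨r + ‖reflectAt l (0 : EuclideanSpace ℝ (Fin N))‖, fun x hx => ?_⟩, ?_⟩
  · have h1 := hr _ hx
    have h2 : ‖x‖ ≤ ‖reflectAt l x‖ + ‖reflectAt l (0 : EuclideanSpace ℝ (Fin N))‖ := by
      calc ‖x‖ = ‖reflectAt l x - reflectAt l 0‖ := by
            rw [norm_reflectAt_sub_reflectAt, sub_zero]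
        _ ≤ _ := norm_sub_le _ _
    rw [mem_ball_zero_iff] at h1 ⊢
    linarith
  · have h1 := (measurePreserving_reflectRight (N := N) l).integrable_comp_of_integrable
      ((measurePreserving_reflectLeft (N := N) l).integrable_comp_of_integrable hu.energy)
    refine h1.congr (Filter.Eventually.of_forall fun p => ?_)
    simp only [Function.comp_apply, reflectLeft_apply, reflectRight_apply, energyDensity]
    rw [kernelK_congr (norm_reflectAt_sub_reflectAt l p.1 p.2)]

end Admissible

/-- The positive part of `h` in the half-space `{x₁ ≥ l}`, extended by zero. -/
noncomputable def posHalf [NeZero N] (l : ℝ) (h : EuclideanSpace ℝ (Fin N) → ℝ)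
    (x : EuclideanSpace ℝ (Fin N)) : ℝ := if l ≤ x 0 then max (h x) 0 else 0

variable [NeZero N] {l : ℝ} {h : EuclideanSpace ℝ (Fin N) → ℝ}

lemma posHalf_nonneg (x : EuclideanSpace ℝ (Fin N)) : 0 ≤ posHalf l h x := by
  unfold posHalf; split_ifs <;> simp

lemma posHalf_of_le {x : EuclideanSpace ℝ (Fin N)} (hx : l ≤ x 0) :
    posHalf l h x = max (h x) 0 := if_pos hx

lemma posHalf_ne_zero {x : EuclideanSpace ℝ (Fin N)} (hx : posHalf l h x ≠ 0) :
    l ≤ x 0 ∧ 0 < h x := by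
  unfold posHalf at hx
  split_ifs at hx with h1
  · refine ⟨h1, ?_⟩
    by_contra h2
    exact hx (max_eq_right (not_lt.1 h2))
  · exact absurd rfl hx

lemma posHalf_reflectAt (hanti : ∀ x, h (reflectAt l x) = -h x) {x : EuclideanSpace ℝ (Fin N)}
    (hx : l ≤ x 0) : posHalf l h (reflectAt l x) = 0 := by
  by_contra hne
  obtain ⟨h1, h2⟩ := posHalf_ne_zero hne
  rw [reflectAt_apply_zero] at h1
  have h3 : x 0 = l := by linarith
  have h4 : reflectAt l x = x := by simp [reflectAt, h3]
  have h5 := hanti x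
  rw [h4] at h5 h2
  linarith

lemma measurable_posHalf (hh : Measurable h) : Measurable (posHalf l h) := by
  have h0 : Measurable fun x : EuclideanSpace ℝ (Fin N) => x 0 := by fun_prop
  exact Measurable.ite (measurableSet_le measurable_const h0) (hh.max measurable_const)
    measurable_const

/-- Passing from an antisymmetric `h` to its positive part in the half-space does not increase the
energy density, once both are summed over the reflections of the two variables. -/
lemma orbitSum_energyDensity_posHalf_le (hanti : ∀ x, h (reflectAt l x) = -h x)
    {x y : EuclideanSpace ℝ (Fin N)} (hx : l ≤ x 0) (hy : l ≤ y 0) :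
    orbitSum l (energyDensity (posHalf l h) (posHalf l h)) (x, y)
      ≤ orbitSum l (energyDensity h h) (x, y) := by
  simp only [orbitSum, energyDensity, hanti, posHalf_reflectAt hanti hx,
    posHalf_reflectAt hanti hy, posHalf_of_le hx, posHalf_of_le hy]
  rw [kernelK_congr (norm_reflectAt_sub_reflectAt l x y),
    kernelK_congr (norm_reflectAt_sub l x y)]
  have hP := kernelK_nonneg (x - y)
  have hQ := kernelK_nonneg (x - reflectAt l y)
  have hQP : x ≠ y → kernelK (x - reflectAt l y) ≤ kernelK (x - y) := fun hne => by
    refine kernelK_anti (sub_ne_zero.2 hne) ?_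
    rw [← norm_reflectAt_sub]
    exact norm_sub_le_norm_reflectAt_sub hx hy
  generalize kernelK (x - reflectAt l y) = Q at *
  rcases eq_or_ne x y with rfl | hne
  · have h1 : (max (h x) 0) ^ 2 ≤ h x ^ 2 := by
      rcases max_cases (h x) 0 with ⟨e, _⟩ | ⟨e, _⟩ <;> rw [e]
      simpa using sq_nonneg (h x)
    nlinarith [mul_le_mul_of_nonneg_right h1 hQ, mul_nonneg (sq_nonneg (h x)) hQ]
  · have hQP := hQP hne
    generalize kernelK (x - y) = P at *
    generalize h x = A
    generalize h y = B
    have h1 : (max A 0 - max B 0) ^ 2 ≤ (A - B) ^ 2 :=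
      sq_le_sq.2 (abs_max_sub_max_le_abs A B 0)
    have h2 : ∀ C : ℝ, (max C 0) ^ 2 ≤ C ^ 2 := fun C => by
      rcases max_cases C 0 with ⟨e, _⟩ | ⟨e, _⟩ <;> rw [e]
      simpa using sq_nonneg C
    have h3 := mul_le_mul_of_nonneg_right (add_le_add (h2 A) (h2 B)) hQ
    have h4 := mul_le_mul_of_nonneg_right h1 hP
    have h5 := mul_le_mul_of_nonneg_left hQP (sq_nonneg (A - B))
    have h6 := mul_nonneg (sq_nonneg (A + B)) hQ
    have h7 := mul_nonneg (sq_nonneg (A - B)) hP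
    linarith

lemma Admissible.posHalf (hh : Admissible h) (hanti : ∀ x, h (reflectAt l x) = -h x) :
    Admissible (posHalf l h) := by
  have hm := measurable_posHalf (l := l) hh.measurable
  obtain ⟨M, hM⟩ := hh.bounded
  obtain ⟨r, hr⟩ := hh.support
  refine ⟨hm, ⟨M, fun x => ?_⟩, ⟨r, fun x hx => hr x (posHalf_ne_zero hx).2.ne'⟩, ?_⟩
  · by_cases hx : _root_.posHalf l h x = 0
    · rw [hx, abs_zero]; exact (abs_nonneg _).trans (hM x)
    · obtain ⟨h1, h2⟩ := posHalf_ne_zero hx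
      rw [posHalf_of_le h1, max_eq_left h2.le]
      exact hM x
  · refine (integrable_orbitSum (l := l) hh.energy).mono'
      (measurable_energyDensity hm hm).aestronglyMeasurable
      (Filter.Eventually.of_forall fun p => ?_)
    rw [Real.norm_of_nonneg (energyDensity_self_nonneg _ p)]
    refine le_trans ?_
      (forall_orbitSum_le (fun x y => orbitSum_energyDensity_posHalf_le hanti) p)
    have := fun q => energyDensity_self_nonneg (_root_.posHalf l h) q
    unfold orbitSum
    linarith [this (reflectAt l p.1, p.2), this (p.1, reflectAt l p.2),
      this (reflectAt l p.1, reflectAt l p.2)]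

end Admissible

/-! ### The form on admissible functions -/

section Form

variable {N : ℕ}

lemma logLapForm_eq (u v : EuclideanSpace ℝ (Fin N) → ℝ) :
    logLapForm u v = 1 / 2 * (∫ p, energyDensity u v p)
      - (∫ p : EuclideanSpace ℝ (Fin N) × EuclideanSpace ℝ (Fin N),
        u p.1 * v p.2 * kernelJ (p.1 - p.2)) + logLapRho N * ∫ x, u x * v x := rfl

lemma logLapForm_const_mul_left (c : ℝ) (u v : EuclideanSpace ℝ (Fin N) → ℝ) :
    logLapForm (fun x => c * u x) v = c * logLapForm u v := by
  have h1 : (∫ p, energyDensity (fun x => c * u x) v p) = c * ∫ p, energyDensity u v p := by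
    rw [← integral_const_mul]
    congr 1; ext p; simp only [energyDensity]; ring
  simp only [logLapForm_eq, h1, mul_assoc, integral_const_mul]
  ring

/-- The integrand of the form `logLapForm a φ` when `a` and `φ` have disjoint supports. -/
noncomputable def crossDensity (a φ : EuclideanSpace ℝ (Fin N) → ℝ)
    (p : EuclideanSpace ℝ (Fin N) × EuclideanSpace ℝ (Fin N)) : ℝ :=
  -(1 / 2) * ((a p.1 * φ p.2 + a p.2 * φ p.1) * fullKernel (p.1 - p.2))

lemma crossDensity_eq {a φ : EuclideanSpace ℝ (Fin N) → ℝ} (hdisj : ∀ x, a x * φ x = 0)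
    (p : EuclideanSpace ℝ (Fin N) × EuclideanSpace ℝ (Fin N)) :
    crossDensity a φ p = 1 / 2 * energyDensity a φ p
      - 1 / 2 * (a p.1 * φ p.2 * kernelJ (p.1 - p.2)
        + a p.2 * φ p.1 * kernelJ (p.2 - p.1)) := by
  rw [kernelJ_congr (norm_sub_rev p.2 p.1), crossDensity, energyDensity, ← kernelK_add_kernelJ]
  linear_combination (-1 / 2 * kernelK (p.1 - p.2)) * (hdisj p.1 + hdisj p.2)

variable [NeZero N] {l : ℝ} {u v φ : EuclideanSpace ℝ (Fin N) → ℝ}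

lemma logLapForm_sub_left (hu : Admissible u) (hv : Admissible v) (hφ : Admissible φ) :
    logLapForm (fun x => u x - v x) φ = logLapForm u φ - logLapForm v φ := by
  have h1 : (∫ p, energyDensity (fun x => u x - v x) φ p) =
      (∫ p, energyDensity u φ p) - ∫ p, energyDensity v φ p := by
    rw [← integral_sub (hu.integrable_energyDensity hφ) (hv.integrable_energyDensity hφ)]
    congr 1; ext p; simp only [energyDensity]; ring
  have h2 : (∫ p : EuclideanSpace ℝ (Fin N) × EuclideanSpace ℝ (Fin N),
      (u p.1 - v p.1) * φ p.2 * kernelJ (p.1 - p.2)) =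
      (∫ p : EuclideanSpace ℝ (Fin N) × EuclideanSpace ℝ (Fin N),
        u p.1 * φ p.2 * kernelJ (p.1 - p.2)) -
      ∫ p : EuclideanSpace ℝ (Fin N) × EuclideanSpace ℝ (Fin N),
        v p.1 * φ p.2 * kernelJ (p.1 - p.2) := by
    rw [← integral_sub (hu.integrable_tail hφ) (hv.integrable_tail hφ)]
    congr 1; ext p; ring
  have h3 : (∫ x, (u x - v x) * φ x) = (∫ x, u x * φ x) - ∫ x, v x * φ x := by
    rw [← integral_sub (hu.integrable_mul hφ) (hv.integrable_mul hφ)]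
    congr 1; ext p; ring
  rw [logLapForm_eq, logLapForm_eq, logLapForm_eq, h1, h2, h3]
  ring

lemma integral_comp_reflectAt (g : EuclideanSpace ℝ (Fin N) → ℝ) (l : ℝ) :
    ∫ x, g (reflectAt l x) = ∫ x, g x :=
  (measurePreserving_reflectEquiv l).integral_comp' g

lemma integral_comp_reflectAt_prod
    (F : EuclideanSpace ℝ (Fin N) × EuclideanSpace ℝ (Fin N) → ℝ) (l : ℝ) :
    ∫ p : EuclideanSpace ℝ (Fin N) × EuclideanSpace ℝ (Fin N),
      F (reflectAt l p.1, reflectAt l p.2) = ∫ p, F p :=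
  ((measurePreserving_reflectRight l).integral_comp' fun p => F (reflectLeft N l p)).trans
    ((measurePreserving_reflectLeft l).integral_comp' F)

lemma logLapForm_comp_reflectAt (u v : EuclideanSpace ℝ (Fin N) → ℝ) (l : ℝ) :
    logLapForm (fun x => u (reflectAt l x)) v = logLapForm u (fun x => v (reflectAt l x)) := by
  rw [logLapForm_eq, logLapForm_eq, ← integral_comp_reflectAt_prod (energyDensity _ v) l,
    ← integral_comp_reflectAt_prod (fun p => u (reflectAt l p.1) * v p.2 * kernelJ (p.1 - p.2)) l,
    ← integral_comp_reflectAt (fun x => u (reflectAt l x) * v x) l]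
  simp only [energyDensity, reflectAt_reflectAt,
    fun x y : EuclideanSpace ℝ (Fin N) => kernelK_congr (norm_reflectAt_sub_reflectAt l x y),
    fun x y : EuclideanSpace ℝ (Fin N) => kernelJ_congr (norm_reflectAt_sub_reflectAt l x y)]

lemma integrable_crossDensity {a φ : EuclideanSpace ℝ (Fin N) → ℝ} (ha : Admissible a)
    (hφ : Admissible φ) (hdisj : ∀ x, a x * φ x = 0) : Integrable (crossDensity a φ) volume := by
  have hJ := ha.integrable_tail hφ
  exact (((ha.integrable_energyDensity hφ).const_mul (1 / 2)).sub
    ((hJ.add (integrable_comp_swap hJ)).const_mul (1 / 2))).congr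
    (Filter.Eventually.of_forall fun p => (crossDensity_eq hdisj p).symm)

/-- Between functions with disjoint supports only the off-diagonal part of the form is left, and it
has the full kernel `c_N |z|^{-N}`. -/
lemma logLapForm_of_disjoint {a φ : EuclideanSpace ℝ (Fin N) → ℝ} (ha : Admissible a)
    (hφ : Admissible φ) (hdisj : ∀ x, a x * φ x = 0) :
    logLapForm a φ = ∫ p, crossDensity a φ p := by
  have hJ := ha.integrable_tail hφ
  have hJ' := integrable_comp_swap hJ
  have e := integral_comp_swap fun p : EuclideanSpace ℝ (Fin N) × EuclideanSpace ℝ (Fin N) =>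
    a p.1 * φ p.2 * kernelJ (p.1 - p.2)
  have hsplit : ∫ p, crossDensity a φ p =
      ∫ p : EuclideanSpace ℝ (Fin N) × EuclideanSpace ℝ (Fin N),
      (1 / 2 * energyDensity a φ p - 1 / 2 * (a p.1 * φ p.2 * kernelJ (p.1 - p.2)
        + a p.2 * φ p.1 * kernelJ (p.2 - p.1))) :=
    integral_congr_ae (Filter.Eventually.of_forall fun p => crossDensity_eq hdisj p)
  have hadd := integral_add hJ hJ'
  have hsub := integral_sub ((ha.integrable_energyDensity hφ).const_mul (1 / 2))
    ((hJ.add hJ').const_mul (1 / 2))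
  simp only [Pi.add_apply] at hadd hsub e
  rw [hsplit, hsub, integral_const_mul, integral_const_mul, hadd, e, logLapForm_eq]
  simp only [hdisj, integral_zero]
  ring

/-- Reflection lowers the interaction of two points of the half-space, so for an antisymmetric `h`
with positive part `φ` in the half-space the negative part of `h` contributes with a good sign. -/
lemma le_orbitSum_crossDensity {h : EuclideanSpace ℝ (Fin N) → ℝ}
    (hanti : ∀ x, h (reflectAt l x) = -h x) {x y : EuclideanSpace ℝ (Fin N)} (hx : l ≤ x 0)
    (hy : l ≤ y 0) :
    1 / 2 * (posHalf l h y * max (-h x) 0 *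
        (fullKernel (x - y) - fullKernel (reflectAt l x - y))
      + posHalf l h x * max (-h y) 0 *
        (fullKernel (x - y) - fullKernel (reflectAt l x - y)))
      ≤ orbitSum l (crossDensity (fun x => h x - posHalf l h x) (posHalf l h)) (x, y) := by
  simp only [orbitSum, crossDensity, hanti, posHalf_reflectAt hanti hx,
    posHalf_reflectAt hanti hy, posHalf_of_le hx, posHalf_of_le hy]
  rw [fullKernel_congr (norm_reflectAt_sub_reflectAt l x y),
    ← fullKernel_congr (norm_reflectAt_sub l x y)]
  have hQ := fullKernel_nonneg (reflectAt l x - y)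
  generalize fullKernel (reflectAt l x - y) = Q at *
  generalize fullKernel (x - y) = P at *
  have key : ∀ A : ℝ, A - max A 0 = - max (-A) 0 := fun A => by
    rcases le_total A 0 with h | h
    · rw [max_eq_right h, max_eq_left (by linarith)]; ring
    · rw [max_eq_left h, max_eq_right (by linarith)]; ring
  have key2 : ∀ A : ℝ, A = max A 0 - max (-A) 0 := fun A => by linarith [key A]
  rw [key (h x), key (h y)]
  have e1 := key2 (h x)
  have e2 := key2 (h y)
  have p1 : 0 ≤ max (h x) 0 := le_max_right _ _
  have p2 : 0 ≤ max (h y) 0 := le_max_right _ _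
  generalize max (h x) 0 = A at *
  generalize max (h y) 0 = B at *
  generalize max (-h x) 0 = A' at *
  generalize max (-h y) 0 = B' at *
  rw [e1, e2]
  nlinarith [mul_nonneg (mul_nonneg p1 p2) hQ]

lemma orbitSum_crossDensity_nonneg {h : EuclideanSpace ℝ (Fin N) → ℝ}
    (hanti : ∀ x, h (reflectAt l x) = -h x) {x y : EuclideanSpace ℝ (Fin N)} (hx : l ≤ x 0)
    (hy : l ≤ y 0) :
    0 ≤ orbitSum l (crossDensity (fun x => h x - posHalf l h x) (posHalf l h)) (x, y) := by
  refine le_trans ?_ (le_orbitSum_crossDensity hanti hx hy)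
  rcases eq_or_ne x y with rfl | hne
  · -- the kernel has the junk value `0` on the diagonal, but there `h⁺ h⁻ = 0`
    have : posHalf l h x * max (-h x) 0 = 0 := by
      rw [posHalf_of_le hx]
      rcases le_total (h x) 0 with h0 | h0
      · rw [max_eq_right h0, zero_mul]
      · rw [max_eq_right (neg_nonpos.2 h0), mul_zero]
    simp [this]
  · have hm : fullKernel (reflectAt l x - y) ≤ fullKernel (x - y) :=
      fullKernel_anti (sub_ne_zero.2 hne) (norm_sub_le_norm_reflectAt_sub hx hy)
    have h1 := posHalf_nonneg (l := l) (h := h) x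
    have h2 := posHalf_nonneg (l := l) (h := h) y
    have h3 := sub_nonneg.2 hm
    positivity

/-- If `h` is negative on a set `M` of the half-space, the form of `h` against its positive part `φ`
in the half-space exceeds the form of `φ` by a multiple of `∫ φ`. The integral of the cross density
is a quarter of that of its orbit sum, which is bounded below pointwise; only the pairs in
`M × supp φ` are counted. -/
lemma logLapForm_posHalf_add_le {h : EuclideanSpace ℝ (Fin N) → ℝ} (hh : Admissible h)
    (hanti : ∀ x, h (reflectAt l x) = -h x) {M : Set (EuclideanSpace ℝ (Fin N))}
    (hM : MeasurableSet M) (hMfin : volume M ≠ ⊤) (hMl : ∀ x ∈ M, l ≤ x 0) {κ : ℝ}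
    (hκ : ∀ x ∈ M, ∀ y, posHalf l h y ≠ 0 →
      κ ≤ max (-h x) 0 * (fullKernel (x - y) - fullKernel (reflectAt l x - y))) :
    logLapForm (posHalf l h) (posHalf l h) + κ / 8 * volume.real M * ∫ y, posHalf l h y
      ≤ logLapForm h (posHalf l h) := by
  have hφ := hh.posHalf hanti
  have hdisj : ∀ x, (h x - posHalf l h x) * posHalf l h x = 0 := fun x => by
    by_cases h0 : posHalf l h x = 0
    · rw [h0, mul_zero]
    · obtain ⟨h1, h2⟩ := posHalf_ne_zero h0
      rw [posHalf_of_le h1, max_eq_left h2.le, sub_self, zero_mul]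
  have ha := hh.sub hφ
  have e1 := logLapForm_sub_left hh hφ hφ
  have e2 := logLapForm_of_disjoint ha hφ hdisj
  have hci := integrable_crossDensity ha hφ hdisj
  have e3 := integral_orbitSum (l := l) hci
  have hMi : Integrable (M.indicator (1 : EuclideanSpace ℝ (Fin N) → ℝ)) volume :=
    (integrable_indicator_iff hM).2 (integrableOn_const hMfin)
  have hFi : Integrable (fun p : EuclideanSpace ℝ (Fin N) × EuclideanSpace ℝ (Fin N) =>
      M.indicator (1 : EuclideanSpace ℝ (Fin N) → ℝ) p.1 * posHalf l h p.2) volume :=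
    hMi.mul_prod hφ.integrable
  have hFe : ∫ p : EuclideanSpace ℝ (Fin N) × EuclideanSpace ℝ (Fin N),
      M.indicator (1 : EuclideanSpace ℝ (Fin N) → ℝ) p.1 * posHalf l h p.2
      = volume.real M * ∫ y, posHalf l h y := by
    rw [Measure.volume_eq_prod,
      integral_prod_mul (M.indicator (1 : EuclideanSpace ℝ (Fin N) → ℝ)) (posHalf l h),
      integral_indicator_one hM]
  have hnn : ∀ p, 0 ≤ orbitSum l
      (crossDensity (fun x => h x - posHalf l h x) (posHalf l h)) p := fun p => by
    have := forall_orbitSum_le (l := l) (F := fun _ => 0)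
      (G := crossDensity (fun x => h x - posHalf l h x) (posHalf l h))
      (fun x y hx hy => by simpa [orbitSum] using orbitSum_crossDensity_nonneg hanti hx hy) p
    simpa [orbitSum] using this
  have e4 : ∫ p : EuclideanSpace ℝ (Fin N) × EuclideanSpace ℝ (Fin N),
      κ / 2 * (M.indicator (1 : EuclideanSpace ℝ (Fin N) → ℝ) p.1 * posHalf l h p.2) ≤
      ∫ p, orbitSum l (crossDensity (fun x => h x - posHalf l h x) (posHalf l h)) p := by
    refine integral_mono (hFi.const_mul _) (integrable_orbitSum hci) fun p => ?_
    obtain ⟨x, y⟩ := p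
    by_cases hx : x ∈ M
    swap
    · simpa [hx] using hnn (x, y)
    by_cases hy : posHalf l h y = 0
    · simpa [hy] using hnn (x, y)
    have hy' := posHalf_ne_zero hy
    refine le_trans ?_ (le_orbitSum_crossDensity hanti (hMl x hx) hy'.1)
    rw [max_eq_right (neg_nonpos.2 hy'.2.le), indicator_of_mem hx]
    have := mul_le_mul_of_nonneg_left (hκ x hx y hy) (posHalf_nonneg (l := l) (h := h) y)
    simp only [Pi.one_apply]
    linarith
  rw [integral_const_mul, hFe] at e4
  linarith

/-- The form of an antisymmetric function against its positive part `φ` in the half-space dominates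
the form of `φ`. -/
lemma logLapForm_posHalf_le {h : EuclideanSpace ℝ (Fin N) → ℝ} (hh : Admissible h)
    (hanti : ∀ x, h (reflectAt l x) = -h x) :
    logLapForm (posHalf l h) (posHalf l h) ≤ logLapForm h (posHalf l h) := by
  simpa using logLapForm_posHalf_add_le hh hanti (M := ∅) MeasurableSet.empty (by simp)
    (by simp) (κ := 0) (by simp)

end Form

/-! ### Coercivity on sets of small measure -/

section SmallVolume

variable {N : ℕ} {φ : EuclideanSpace ℝ (Fin N) → ℝ}

/-- The Cauchy–Schwarz inequality for a function and the indicator of a set outside of which it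
vanishes. -/
lemma sq_integral_le_measureReal_mul (hφ : Admissible φ) {A : Set (EuclideanSpace ℝ (Fin N))}
    (hA : MeasurableSet A) (hAfin : volume A ≠ ⊤) (hsupp : ∀ x, φ x ≠ 0 → x ∈ A) :
    (∫ x, φ x) ^ 2 ≤ volume.real A * ∫ x, φ x * φ x := by
  have hsq := hφ.integrable_mul hφ
  have i1 : Integrable (A.indicator (1 : EuclideanSpace ℝ (Fin N) → ℝ)) volume :=
    (integrable_indicator_iff hA).2 (integrableOn_const hAfin)
  -- the discriminant of `t ↦ ∫ (t φ - 1_A)²` is nonpositive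
  have key : ∀ t : ℝ, 0 ≤ (∫ x, φ x * φ x) * (t * t) + (-2 * ∫ x, φ x) * t + volume.real A := by
    intro t
    have e : ∫ x, (t * t * (φ x * φ x) - 2 * t * φ x
        + A.indicator (1 : EuclideanSpace ℝ (Fin N) → ℝ) x) =
        (∫ x, φ x * φ x) * (t * t) + (-2 * ∫ x, φ x) * t + volume.real A := by
      have hsub := integral_sub (hsq.const_mul (t * t)) (hφ.integrable.const_mul (2 * t))
      have hadd := integral_add
        ((hsq.const_mul (t * t)).sub (hφ.integrable.const_mul (2 * t))) i1
      simp only [Pi.sub_apply] at hsub hadd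
      rw [hadd, hsub, integral_const_mul, integral_const_mul, integral_indicator_one hA]
      ring
    rw [← e]
    refine integral_nonneg fun x => ?_
    simp only [Pi.zero_apply]
    by_cases hx : x ∈ A
    · rw [indicator_of_mem hx, Pi.one_apply]
      nlinarith [sq_nonneg (t * φ x - 1)]
    · rw [indicator_of_notMem hx, not_imp_comm.1 (hsupp x) hx]
      simp
  have := discrim_le_zero key
  rw [discrim] at this
  linarith

/-- Replacing `k` by a truncation of it gives a lower bound for the form with an arbitrarily large
multiple of the `L²` norm, up to a multiple of the square of the integral. -/
lemma exists_le_logLapForm_self (N : ℕ) [NeZero N] (K : ℝ) :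
    ∃ C, 0 < C ∧ ∀ φ : EuclideanSpace ℝ (Fin N) → ℝ, Admissible φ → (∀ x, 0 ≤ φ x) →
      K * (∫ x, φ x * φ x) - C * (∫ x, φ x) ^ 2 ≤ logLapForm φ φ := by
  obtain ⟨ε, hε, hK⟩ := exists_le_integral_truncKernel N (K - logLapRho N)
  have hc := logLapC_pos N
  refine ⟨logLapC N / ε ^ N + logLapC N, by positivity, fun φ hφ hpos => ?_⟩
  have hsq := hφ.integrable_mul hφ
  have hti := integrable_truncKernel (N := N) hε
  have i1 := integrable_mul_comp_sub hsq hti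
  have i2 : Integrable (fun p : EuclideanSpace ℝ (Fin N) × EuclideanSpace ℝ (Fin N) =>
      φ p.1 * φ p.2) volume := hφ.integrable.mul_prod hφ.integrable
  have e1 := integral_mul_comp_sub hsq hti
  have e1' := integral_comp_swap fun p : EuclideanSpace ℝ (Fin N) × EuclideanSpace ℝ (Fin N) =>
    φ p.2 * φ p.2 * truncKernel ε (p.1 - p.2)
  have e2 : ∫ p : EuclideanSpace ℝ (Fin N) × EuclideanSpace ℝ (Fin N), φ p.1 * φ p.2
      = (∫ x, φ x) ^ 2 := by
    rw [Measure.volume_eq_prod, integral_prod_mul φ φ, sq]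
  have hsymm : ∀ x y : EuclideanSpace ℝ (Fin N), truncKernel ε (x - y) = truncKernel ε (y - x) :=
    fun x y => by
      simp only [truncKernel, indicator, mem_ofPred_eq, norm_sub_rev x y,
        kernelK_congr (norm_sub_rev x y)]
  -- the energy
  have b1 : ∫ p : EuclideanSpace ℝ (Fin N) × EuclideanSpace ℝ (Fin N),
      ((φ p.2 * φ p.2 * truncKernel ε (p.1 - p.2) + φ p.1 * φ p.1 * truncKernel ε (p.2 - p.1))
        - 2 * (logLapC N / ε ^ N) * (φ p.1 * φ p.2)) ≤ ∫ p, energyDensity φ φ p := by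
    refine integral_mono ((i1.add (integrable_comp_swap i1)).sub (i2.const_mul _)) hφ.energy
      fun p => ?_
    have h1 := mul_le_mul_of_nonneg_left (truncKernel_le_kernelK ε (p.1 - p.2))
      (mul_self_nonneg (φ p.1 - φ p.2))
    have h2 := mul_le_mul_of_nonneg_left (truncKernel_le hε (p.1 - p.2))
      (mul_nonneg (hpos p.1) (hpos p.2))
    simp only [energyDensity]
    rw [hsymm p.2 p.1]
    linarith
  have b1' := integral_sub (i1.add (integrable_comp_swap i1))
    (i2.const_mul (2 * (logLapC N / ε ^ N)))
  have b1'' := integral_add i1 (integrable_comp_swap i1)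
  simp only [Pi.add_apply] at b1' b1'' e1'
  rw [b1', b1'', e1', e1, integral_const_mul, e2] at b1
  -- the tail
  have b2 : (∫ p : EuclideanSpace ℝ (Fin N) × EuclideanSpace ℝ (Fin N),
      φ p.1 * φ p.2 * kernelJ (p.1 - p.2)) ≤ logLapC N * (∫ x, φ x) ^ 2 := by
    rw [← e2, ← integral_const_mul]
    refine integral_mono (hφ.integrable_tail hφ) (i2.const_mul _) fun p => ?_
    have := mul_le_mul_of_nonneg_left (kernelJ_le (p.1 - p.2))
      (mul_nonneg (hpos p.1) (hpos p.2))
    simp only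
    linarith
  have b3 : 0 ≤ ∫ x, φ x * φ x := integral_nonneg fun x => mul_self_nonneg _
  have b4 := mul_le_mul_of_nonneg_left hK b3
  rw [logLapForm_eq]
  linarith

/-- The form is coercive, with an arbitrarily large constant, on nonnegative functions supported in
a set of small measure. -/
lemma exists_measure_le_logLapForm_self (N : ℕ) [NeZero N] (K : ℝ) :
    ∃ δ > 0, ∀ (φ : EuclideanSpace ℝ (Fin N) → ℝ) (A : Set (EuclideanSpace ℝ (Fin N))),
      Admissible φ → (∀ x, 0 ≤ φ x) → MeasurableSet A → volume A ≤ ENNReal.ofReal δ →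
      (∀ x, φ x ≠ 0 → x ∈ A) → K * (∫ x, φ x * φ x) ≤ logLapForm φ φ := by
  obtain ⟨C, hC, h⟩ := exists_le_logLapForm_self N (K + 1)
  refine ⟨1 / C, by positivity, fun φ A hφ hpos hA hAδ hsupp => ?_⟩
  have h1 := h φ hφ hpos
  have h2 := sq_integral_le_measureReal_mul hφ hA (hAδ.trans_lt ENNReal.ofReal_lt_top).ne hsupp
  have h3 : volume.real A ≤ 1 / C := ENNReal.toReal_le_of_le_ofReal (by positivity) hAδ
  have h4 : 0 ≤ ∫ x, φ x * φ x := integral_nonneg fun x => mul_self_nonneg _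
  have h5 : C * (∫ x, φ x) ^ 2 ≤ ∫ x, φ x * φ x := by
    calc C * (∫ x, φ x) ^ 2 ≤ C * (1 / C * ∫ x, φ x * φ x) := by gcongr; exact h2.trans (by gcongr)
      _ = _ := by field_simp
  linarith

end SmallVolume

/-! ### Lipschitz functions in the form -/

section Lipschitz

variable {N : ℕ} [NeZero N] {g : EuclideanSpace ℝ (Fin N) → ℝ}

lemma admissible_of_lipschitz {L M r : ℝ} (hL : ∀ x y, |g x - g y| ≤ L * ‖x - y‖)
    (hM : ∀ x, |g x| ≤ M) (hr : ∀ x, g x ≠ 0 → x ∈ ball (0 : EuclideanSpace ℝ (Fin N)) r) :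
    Admissible g := by
  have hg : Measurable g := by
    refine (LipschitzWith.of_dist_le_mul (K := L.toNNReal) fun x y => ?_).continuous.measurable
    rw [Real.dist_eq, dist_eq_norm]
    exact (hL x y).trans (mul_le_mul_of_nonneg_right (Real.le_coe_toNNReal L) (norm_nonneg _))
  refine ⟨hg, ⟨M, hM⟩, ⟨r, hr⟩, ?_⟩
  have i0 : Integrable ((ball (0 : EuclideanSpace ℝ (Fin N)) r).indicator
      (1 : EuclideanSpace ℝ (Fin N) → ℝ)) volume :=
    (integrable_indicator_iff measurableSet_ball).2 (integrableOn_const measure_ball_lt_top.ne)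
  have i1 := integrable_mul_comp_sub i0 (integrable_norm_mul_kernelK (N := N))
  refine ((i1.add (integrable_comp_swap i1)).const_mul (L ^ 2)).mono'
    (measurable_energyDensity hg hg).aestronglyMeasurable (Filter.Eventually.of_forall fun p => ?_)
  obtain ⟨x, y⟩ := p
  rw [Real.norm_of_nonneg (energyDensity_self_nonneg _ _)]
  simp only [energyDensity, Pi.add_apply]
  rw [norm_sub_rev y x, kernelK_congr (norm_sub_rev y x), ← add_mul]
  have hk := kernelK_nonneg (x - y)
  have hi : ∀ z, 0 ≤ (ball (0 : EuclideanSpace ℝ (Fin N)) r).indicator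
      (1 : EuclideanSpace ℝ (Fin N) → ℝ) z := fun z => indicator_nonneg (by simp) z
  by_cases h0 : g x = 0 ∧ g y = 0
  · rw [h0.1, h0.2, sub_zero, mul_zero, zero_mul]
    have := hi x
    have := hi y
    positivity
  · have h1 : 1 ≤ (ball (0 : EuclideanSpace ℝ (Fin N)) r).indicator
        (1 : EuclideanSpace ℝ (Fin N) → ℝ) y + (ball (0 : EuclideanSpace ℝ (Fin N)) r).indicator
        (1 : EuclideanSpace ℝ (Fin N) → ℝ) x := by
      by_cases hx : g x = 0
      · have hy : g y ≠ 0 := fun hy => h0 ⟨hx, hy⟩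
        have := hi x
        rw [indicator_of_mem (hr y hy), Pi.one_apply]
        linarith
      · have := hi y
        rw [indicator_of_mem (hr x hx), Pi.one_apply]
        linarith
    have h2 : (g x - g y) * (g x - g y) * kernelK (x - y) ≤
        L ^ 2 * (‖x - y‖ * kernelK (x - y)) := by
      by_cases hxy : ‖x - y‖ < 1
      · have h3 : (g x - g y) * (g x - g y) ≤ L ^ 2 * ‖x - y‖ := by
          calc (g x - g y) * (g x - g y) = |g x - g y| ^ 2 := by rw [sq_abs, sq]
            _ ≤ (L * ‖x - y‖) ^ 2 := by gcongr; exact hL x y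
            _ = L ^ 2 * (‖x - y‖ * ‖x - y‖) := by ring
            _ ≤ L ^ 2 * (‖x - y‖ * 1) := by gcongr
            _ = _ := by ring
        calc _ ≤ L ^ 2 * ‖x - y‖ * kernelK (x - y) := by gcongr
          _ = _ := by ring
      · rw [kernelK_eq, if_neg hxy]; simp
    refine h2.trans ?_
    exact mul_le_mul_of_nonneg_left (le_mul_of_one_le_left (by positivity) h1) (sq_nonneg L)

/-- Against nonnegative test functions a Lipschitz function behaves in the form like one with a
bounded image under the operator. -/
lemma exists_logLapForm_le_integral {L M r : ℝ} (hL : ∀ x y, |g x - g y| ≤ L * ‖x - y‖)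
    (hM : ∀ x, |g x| ≤ M) (hr : ∀ x, g x ≠ 0 → x ∈ ball (0 : EuclideanSpace ℝ (Fin N)) r) :
    ∃ C, ∀ φ : EuclideanSpace ℝ (Fin N) → ℝ, Admissible φ → (∀ x, 0 ≤ φ x) →
      logLapForm g φ ≤ C * ∫ x, φ x := by
  have hg := admissible_of_lipschitz hL hM hr
  refine ⟨L * (∫ z : EuclideanSpace ℝ (Fin N), ‖z‖ * kernelK z) + logLapC N * (∫ x, |g x|)
    + |logLapRho N| * M, fun φ hφ hpos => ?_⟩
  have i1 := integrable_mul_comp_sub hφ.integrable (integrable_norm_mul_kernelK (N := N))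
  have e1 := integral_mul_comp_sub hφ.integrable (integrable_norm_mul_kernelK (N := N))
  have e1' := integral_comp_swap fun p : EuclideanSpace ℝ (Fin N) × EuclideanSpace ℝ (Fin N) =>
    φ p.2 * (‖p.1 - p.2‖ * kernelK (p.1 - p.2))
  have b1'' := integral_add i1 (integrable_comp_swap i1)
  simp only at e1' b1''
  have b1 : ∫ p, energyDensity g φ p ≤ ∫ p : EuclideanSpace ℝ (Fin N) × EuclideanSpace ℝ (Fin N),
      L * (φ p.2 * (‖p.1 - p.2‖ * kernelK (p.1 - p.2))
        + φ p.1 * (‖p.2 - p.1‖ * kernelK (p.2 - p.1))) := by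
    refine integral_mono (hg.integrable_energyDensity hφ)
      ((i1.add (integrable_comp_swap i1)).const_mul L) fun p => ?_
    obtain ⟨x, y⟩ := p
    simp only [energyDensity]
    rw [norm_sub_rev y x, kernelK_congr (norm_sub_rev y x)]
    have hk := kernelK_nonneg (x - y)
    have h1 : (g x - g y) * (φ x - φ y) ≤ L * ‖x - y‖ * (φ x + φ y) := by
      calc (g x - g y) * (φ x - φ y) ≤ |g x - g y| * |φ x - φ y| := by
            rw [← abs_mul]; exact le_abs_self _
        _ ≤ L * ‖x - y‖ * (φ x + φ y) := by
            refine mul_le_mul (hL x y) ?_ (abs_nonneg _) ((abs_nonneg _).trans (hL x y))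
            rw [abs_le]
            constructor <;> linarith [hpos x, hpos y]
    linarith [mul_le_mul_of_nonneg_right h1 hk]
  rw [integral_const_mul, b1'', e1', e1] at b1
  have e2 : ∫ p : EuclideanSpace ℝ (Fin N) × EuclideanSpace ℝ (Fin N), |g p.1| * φ p.2
      = (∫ x, |g x|) * ∫ x, φ x := by
    rw [Measure.volume_eq_prod, integral_prod_mul (fun x => |g x|) φ]
  have b2 : -(∫ p : EuclideanSpace ℝ (Fin N) × EuclideanSpace ℝ (Fin N),
      g p.1 * φ p.2 * kernelJ (p.1 - p.2)) ≤ logLapC N * ((∫ x, |g x|) * ∫ x, φ x) := by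
    rw [← e2, ← integral_const_mul, ← integral_neg]
    have i2 : Integrable (fun p : EuclideanSpace ℝ (Fin N) × EuclideanSpace ℝ (Fin N) =>
      |g p.1| * φ p.2) volume := hg.integrable.abs.mul_prod hφ.integrable
    refine integral_mono (hg.integrable_tail hφ).neg (i2.const_mul _) fun p => ?_
    have h1 : -(g p.1 * φ p.2) ≤ |g p.1| * φ p.2 := by
      rw [← neg_mul]
      exact mul_le_mul_of_nonneg_right (neg_le_abs _) (hpos _)
    have h2 := mul_le_mul_of_nonneg_right h1 (kernelJ_nonneg (p.1 - p.2))
    have h3 := mul_le_mul_of_nonneg_left (kernelJ_le (p.1 - p.2))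
      (mul_nonneg (abs_nonneg (g p.1)) (hpos p.2))
    simp only
    linarith
  have b3 : logLapRho N * (∫ x, g x * φ x) ≤ |logLapRho N| * (M * ∫ x, φ x) := by
    rw [← integral_const_mul M, ← integral_const_mul, ← integral_const_mul]
    refine integral_mono ((hg.integrable_mul hφ).const_mul _)
      ((hφ.integrable.const_mul _).const_mul _) fun x => ?_
    calc logLapRho N * (g x * φ x) ≤ |logLapRho N * (g x * φ x)| := le_abs_self _
      _ = |logLapRho N| * (|g x| * φ x) := by rw [abs_mul, abs_mul, abs_of_nonneg (hpos x)]
      _ ≤ |logLapRho N| * (M * φ x) := by gcongr; exacts [hpos x, hM x]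
  rw [logLapForm_eq]
  linarith

end Lipschitz

/-! ### The moving plane method -/

section MovingPlane

variable {N : ℕ} [NeZero N] {Ω : Set (EuclideanSpace ℝ (Fin N))} {f : ℝ → ℝ}
  {u : EuclideanSpace ℝ (Fin N) → ℝ} {l : ℝ}

/-- What the moving plane method uses of the domain, of the nonlinearity and of the solution.
These properties are inherited by the reflection of `u` about `{x₁ = 0}`. -/
structure MovingPlaneData (Ω : Set (EuclideanSpace ℝ (Fin N))) (f : ℝ → ℝ)
    (u : EuclideanSpace ℝ (Fin N) → ℝ) : Prop where
  isOpen : IsOpen Ω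
  isBounded : Bornology.IsBounded Ω
  convex : ConvexInDirection (e1 N) Ω
  symm : ∀ x, reflectFirst x ∈ Ω ↔ x ∈ Ω
  continuous_f : Continuous f
  admissible : Admissible u
  continuousOn : ContinuousOn u Ω
  pos : ∀ x ∈ Ω, 0 < u x
  zero : ∀ x ∉ Ω, u x = 0
  lipschitz : ∃ L, 0 ≤ L ∧ ∀ x y, |f (u x) - f (u y)| ≤ L * |u x - u y|
  solution : ∀ φ : EuclideanSpace ℝ (Fin N) → ℝ, Admissible φ → (∀ x, 0 ≤ φ x) →
    (∀ x ∉ Ω, φ x = 0) → logLapForm u φ = ∫ x, f (u x) * φ x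

/-- The difference of `u` and its reflection about `{x₁ = l}`. -/
noncomputable def reflectDiff (l : ℝ) (u : EuclideanSpace ℝ (Fin N) → ℝ)
    (x : EuclideanSpace ℝ (Fin N)) : ℝ := u x - u (reflectAt l x)

lemma reflectDiff_reflectAt (x : EuclideanSpace ℝ (Fin N)) :
    reflectDiff l u (reflectAt l x) = -reflectDiff l u x := by
  simp [reflectDiff]

lemma continuous_apply_zero : Continuous fun x : EuclideanSpace ℝ (Fin N) => x 0 := by
  fun_prop

lemma continuous_reflectAt_left (x : EuclideanSpace ℝ (Fin N)) :
    Continuous fun l => reflectAt l x := by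
  unfold reflectAt
  fun_prop

lemma volume_hyperplane (l : ℝ) :
    volume {x : EuclideanSpace ℝ (Fin N) | x 0 = l} = 0 := by
  have h := Measure.addHaar_affineSubspace (volume : Measure (EuclideanSpace ℝ (Fin N)))
    (AffineSubspace.mk' (l • e1 N) (ℝ ∙ e1 N)ᗮ) (fun htop => by
      have h1 : (l + 1) • e1 N ∈ AffineSubspace.mk' (l • e1 N) (ℝ ∙ e1 N)ᗮ := by
        rw [htop]; trivial
      rw [AffineSubspace.mem_mk', Submodule.mem_orthogonal_singleton_iff_inner_left, inner_e1] at h1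
      simp [e1_apply_zero] at h1)
  convert h using 2
  ext x
  rw [SetLike.mem_coe, AffineSubspace.mem_mk', Submodule.mem_orthogonal_singleton_iff_inner_left,
    inner_e1]
  simp [e1_apply_zero, sub_eq_zero]

/-- If the positive part of `h` in the half-space vanishes almost everywhere, then `h ≤ 0` at every
interior point of the half-space at which `h` is continuous. -/
lemma le_zero_of_posHalf_ae_zero {h : EuclideanSpace ℝ (Fin N) → ℝ}
    (hae : ∀ᵐ x, posHalf l h x = 0) {x : EuclideanSpace ℝ (Fin N)} (hcont : ContinuousAt h x)
    (hlx : l < x 0) : h x ≤ 0 := by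
  by_contra! hpos
  have hnear : ∀ᶠ y in nhds x, 0 < h y ∧ l < y 0 :=
    (hcont.eventually_const_lt hpos).and
      (continuous_apply_zero.continuousAt.eventually_const_lt hlx)
  have hmem : {y | posHalf l h y = 0}ᶜ ∈ nhds x := by
    filter_upwards [hnear] with y hy
    simp only [mem_compl_iff, mem_ofPred_eq]
    rw [posHalf_of_le hy.2.le, max_eq_left hy.1.le]
    exact hy.1.ne'
  exact (Measure.measure_pos_of_mem_nhds volume hmem).ne' hae

namespace MovingPlaneData

lemma nonneg (D : MovingPlaneData Ω f u) (x : EuclideanSpace ℝ (Fin N)) : 0 ≤ u x := by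
  by_cases hx : x ∈ Ω
  · exact (D.pos x hx).le
  · exact (D.zero x hx).ge

lemma admissible_reflectDiff (D : MovingPlaneData Ω f u) : Admissible (reflectDiff l u) :=
  D.admissible.sub (D.admissible.comp_reflectAt l)

lemma reflectAt_mem (D : MovingPlaneData Ω f u) (hl : 0 ≤ l)
    {x : EuclideanSpace ℝ (Fin N)} (hx : x ∈ Ω) (hlx : l ≤ x 0) :
    reflectAt l x ∈ Ω := by
  have h1 := (D.symm x).2 hx
  have h2 : reflectFirst x = x + (-(2 * x 0)) • e1 N := by
    rw [reflectFirst, neg_smul, sub_eq_add_neg]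
  rw [h2] at h1
  refine D.convex x hx _ h1 ?_
  rw [segment_eq_image']
  rcases (hl.trans hlx).eq_or_lt with h0 | h0
  · refine ⟨0, by simp, ?_⟩
    have : x 0 - l = 0 := by linarith
    simp [reflectAt, this]
  · refine ⟨(x 0 - l) / x 0, ⟨by apply div_nonneg <;> linarith, ?_⟩, ?_⟩
    · rw [div_le_one h0]; linarith
    · have : (x 0 - l) / x 0 * -(2 * x 0) = -(2 * (x 0 - l)) := by field_simp
      simp only [add_sub_cancel_left, smul_smul, this]
      simp only [reflectAt, neg_smul, ← sub_eq_add_neg]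

lemma continuousAt_reflectDiff (D : MovingPlaneData Ω f u) (hl : 0 ≤ l)
    {x : EuclideanSpace ℝ (Fin N)} (hx : x ∈ Ω)
    (hlx : l ≤ x 0) : ContinuousAt (reflectDiff l u) x := by
  have h1 := D.continuousOn.continuousAt (D.isOpen.mem_nhds hx)
  have h2 := D.continuousOn.continuousAt (D.isOpen.mem_nhds (D.reflectAt_mem hl hx hlx))
  exact h1.sub (ContinuousAt.comp' h2 (continuous_reflectAt l).continuousAt)

lemma integrable_f_mul (D : MovingPlaneData Ω f u)
    {φ : EuclideanSpace ℝ (Fin N) → ℝ} (hφ : Admissible φ) (l : ℝ) :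
    Integrable (fun x => f (u (reflectAt l x)) * φ x) volume := by
  obtain ⟨M, hM⟩ := D.admissible.bounded
  obtain ⟨L, hL0, hL⟩ := D.lipschitz
  refine hφ.integrable.bdd_mul (c := |f (u 0)| + L * (M + M))
    (D.continuous_f.measurable.comp (D.admissible.comp_reflectAt l).measurable).aestronglyMeasurable
    (Filter.Eventually.of_forall fun x => ?_)
  have h1 := hL (reflectAt l x) 0
  have h2 : |u (reflectAt l x) - u 0| ≤ M + M := (abs_sub _ _).trans (add_le_add (hM _) (hM _))
  have h3 := mul_le_mul_of_nonneg_left h2 hL0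
  have h4 := abs_sub_abs_le_abs_sub (f (u (reflectAt l x))) (f (u 0))
  rw [Real.norm_eq_abs]
  linarith

/-- The equation for the difference of `u` and its reflection. -/
lemma logLapForm_reflectDiff (D : MovingPlaneData Ω f u)
    {φ : EuclideanSpace ℝ (Fin N) → ℝ} (hφ : Admissible φ)
    (hpos : ∀ x, 0 ≤ φ x) (hl : 0 ≤ l) (hsupp : ∀ x, φ x ≠ 0 → x ∈ Ω ∧ l ≤ x 0) :
    Integrable (fun x => (f (u x) - f (u (reflectAt l x))) * φ x) volume ∧
    logLapForm (reflectDiff l u) φ = ∫ x, (f (u x) - f (u (reflectAt l x))) * φ x := by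
  have i1 : Integrable (fun x => f (u x) * φ x) volume := by
    have h := D.integrable_f_mul (hφ.comp_reflectAt l) l
    refine ((measurePreserving_reflectEquiv l).integrable_comp_of_integrable h).congr
      (Filter.Eventually.of_forall fun x => ?_)
    simp
  have i2 := D.integrable_f_mul hφ l
  have e1 := D.solution φ hφ hpos fun x hx => not_imp_comm.1 (fun h => (hsupp x h).1) hx
  have e2 := D.solution _ (hφ.comp_reflectAt l) (fun x => hpos _) fun x hx => by
    by_contra h0
    obtain ⟨h1, h2⟩ := hsupp _ h0
    exact hx (by simpa using D.reflectAt_mem hl h1 h2)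
  rw [← integral_comp_reflectAt _ l] at e2
  simp only [reflectAt_reflectAt] at e2
  have e3 := logLapForm_sub_left D.admissible (D.admissible.comp_reflectAt l) hφ
  rw [logLapForm_comp_reflectAt, e1, e2, ← integral_sub i1 i2] at e3
  simp only [← sub_mul] at e3
  refine ⟨?_, e3⟩
  exact (i1.sub i2).congr (Filter.Eventually.of_forall fun x => (sub_mul _ _ _).symm)

/-- The maximum principle in sets of small measure: the reflection inequality holds as soon as it
fails only on a set of small measure, uniformly in the position of the hyperplane. -/
lemma exists_measure_le_reflect (D : MovingPlaneData Ω f u) :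
    ∃ δ > 0, ∀ l, 0 ≤ l →
    volume {x | x ∈ Ω ∧ l ≤ x 0 ∧ 0 < reflectDiff l u x} ≤ ENNReal.ofReal δ →
    ∀ x ∈ Ω, l ≤ x 0 → u x ≤ u (reflectAt l x) := by
  obtain ⟨L, hL0, hL⟩ := D.lipschitz
  obtain ⟨δ, hδ, hcoer⟩ := exists_measure_le_logLapForm_self N (L + 1)
  refine ⟨δ, hδ, fun l hl hvol x hx hlx => ?_⟩
  have hh := D.admissible_reflectDiff (l := l)
  have hφ := hh.posHalf reflectDiff_reflectAt
  have hsupp : ∀ x, posHalf l (reflectDiff l u) x ≠ 0 →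
      x ∈ Ω ∧ l ≤ x 0 ∧ 0 < reflectDiff l u x := fun x h0 => by
    obtain ⟨h1, h2⟩ := posHalf_ne_zero h0
    refine ⟨?_, h1, h2⟩
    by_contra hxΩ
    rw [reflectDiff, D.zero x hxΩ] at h2
    linarith [D.nonneg (reflectAt l x)]
  have hmeas : MeasurableSet {x | x ∈ Ω ∧ l ≤ x 0 ∧ 0 < reflectDiff l u x} :=
    D.isOpen.measurableSet.inter ((measurableSet_le measurable_const
      continuous_apply_zero.measurable).inter (measurableSet_lt measurable_const hh.measurable))
  have h1 := hcoer _ _ hφ posHalf_nonneg hmeas hvol hsupp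
  have h2 := logLapForm_posHalf_le hh reflectDiff_reflectAt
  obtain ⟨hint, h3⟩ := D.logLapForm_reflectDiff hφ posHalf_nonneg hl
    fun x h0 => ⟨(hsupp x h0).1, (hsupp x h0).2.1⟩
  have hsq := hφ.integrable_mul hφ
  have h4 : ∫ x, (f (u x) - f (u (reflectAt l x))) * posHalf l (reflectDiff l u) x ≤
      L * ∫ x, posHalf l (reflectDiff l u) x * posHalf l (reflectDiff l u) x := by
    rw [← integral_const_mul]
    refine integral_mono hint (hsq.const_mul L) fun x => ?_
    by_cases h0 : posHalf l (reflectDiff l u) x = 0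
    · simp [h0]
    · obtain ⟨h1, h2⟩ := posHalf_ne_zero h0
      have h5 := (le_abs_self _).trans (hL x (reflectAt l x))
      simp only
      rw [posHalf_of_le h1, max_eq_left h2.le, ← mul_assoc]
      refine mul_le_mul_of_nonneg_right ?_ h2.le
      rwa [← abs_of_pos h2]
  have h5 : ∫ x, posHalf l (reflectDiff l u) x * posHalf l (reflectDiff l u) x = 0 :=
    le_antisymm (by linarith) (integral_nonneg fun x => mul_self_nonneg _)
  rw [integral_eq_zero_iff_of_nonneg (fun x => mul_self_nonneg _) hsq] at h5
  rcases hlx.eq_or_lt with h6 | h6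
  · simp [reflectAt, h6]
  · have := le_zero_of_posHalf_ae_zero (h5.mono fun x hx => by simpa using hx)
      (D.continuousAt_reflectDiff hl hx hlx) h6
    simpa [reflectDiff] using this

end MovingPlaneData

end MovingPlane

/-! ### The strong maximum principle -/

section StrongMaximumPrinciple

variable {N : ℕ} [NeZero N] {Ω : Set (EuclideanSpace ℝ (Fin N))} {f : ℝ → ℝ}
  {u : EuclideanSpace ℝ (Fin N) → ℝ} {l : ℝ}

/-- The tent function of height `r` over the ball of radius `r` about `a`, made antisymmetric with
respect to `{x₁ = l}`. -/
noncomputable def antisymmTent (l r : ℝ) (a x : EuclideanSpace ℝ (Fin N)) : ℝ :=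
  max (r - ‖x - a‖) 0 - max (r - ‖reflectAt l x - a‖) 0

lemma antisymmTent_reflectAt (r : ℝ) (a x : EuclideanSpace ℝ (Fin N)) :
    antisymmTent l r a (reflectAt l x) = -antisymmTent l r a x := by
  simp [antisymmTent]

lemma antisymmTent_le (r : ℝ) (a x : EuclideanSpace ℝ (Fin N)) :
    antisymmTent l r a x ≤ max (r - ‖x - a‖) 0 :=
  sub_le_self _ (le_max_right _ _)

lemma continuous_antisymmTent (r : ℝ) (a : EuclideanSpace ℝ (Fin N)) :
    Continuous (antisymmTent l r a) := by
  have := continuous_reflectAt (N := N) l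
  unfold antisymmTent
  fun_prop

lemma abs_antisymmTent_sub_le (r : ℝ) (a x y : EuclideanSpace ℝ (Fin N)) :
    |antisymmTent l r a x - antisymmTent l r a y| ≤ 2 * ‖x - y‖ := by
  have key : ∀ z w : EuclideanSpace ℝ (Fin N),
      |max (r - ‖z - a‖) 0 - max (r - ‖w - a‖) 0| ≤ ‖z - w‖ := fun z w => by
    refine (abs_max_sub_max_le_abs _ _ _).trans ?_
    have h := abs_norm_sub_norm_le (w - a) (z - a)
    rw [sub_sub_sub_cancel_right, norm_sub_rev w z] at h
    rwa [sub_sub_sub_cancel_left]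
  have h1 := key x y
  have h2 := key (reflectAt l x) (reflectAt l y)
  rw [norm_reflectAt_sub_reflectAt] at h2
  rw [antisymmTent, antisymmTent, sub_sub_sub_comm]
  exact (abs_sub _ _).trans (by linarith)

lemma abs_antisymmTent_le {r : ℝ} (hr : 0 ≤ r) (a x : EuclideanSpace ℝ (Fin N)) :
    |antisymmTent l r a x| ≤ r := by
  have key : ∀ z : EuclideanSpace ℝ (Fin N), 0 ≤ max (r - ‖z - a‖) 0 ∧ max (r - ‖z - a‖) 0 ≤ r :=
    fun z => ⟨le_max_right _ _, max_le (sub_le_self _ (norm_nonneg _)) hr⟩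
  have h1 := key x
  have h2 := key (reflectAt l x)
  rw [antisymmTent, abs_le]
  constructor <;> linarith [h1.1, h1.2, h2.1, h2.2]

lemma exists_antisymmTent_support (l r : ℝ) (a : EuclideanSpace ℝ (Fin N)) :
    ∃ R, ∀ x, antisymmTent l r a x ≠ 0 → x ∈ ball (0 : EuclideanSpace ℝ (Fin N)) R := by
  refine ⟨r + ‖a‖ + ‖reflectAt l a‖, fun x hx => ?_⟩
  rw [mem_ball_zero_iff]
  by_contra! hR
  refine hx ?_
  have h1 : ‖x‖ ≤ ‖x - a‖ + ‖a‖ := by simpa using norm_add_le (x - a) a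
  have h2 : ‖x‖ ≤ ‖x - reflectAt l a‖ + ‖reflectAt l a‖ := by
    simpa using norm_add_le (x - reflectAt l a) (reflectAt l a)
  have h3 := norm_nonneg a
  have h4 := norm_nonneg (reflectAt l a)
  rw [antisymmTent, norm_reflectAt_sub, max_eq_right (by linarith), max_eq_right (by linarith),
    sub_zero]

/-- On a compact subset of the open half-space, away from the diagonal, reflecting one of the points
lowers the kernel by a definite amount. -/
lemma exists_le_fullKernel_sub {M B : Set (EuclideanSpace ℝ (Fin N))} (hM : IsCompact M)
    (hB : IsCompact B) (hMl : ∀ x ∈ M, l < x 0) (hBl : ∀ y ∈ B, l < y 0) (hMB : Disjoint M B) :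
    ∃ κ > 0, ∀ x ∈ M, ∀ y ∈ B,
      κ ≤ fullKernel (x - y) - fullKernel (reflectAt l x - y) := by
  have hpos : ∀ x ∈ M, ∀ y ∈ B, 0 < ‖x - y‖ ∧ ‖x - y‖ < ‖reflectAt l x - y‖ := by
    intro x hx y hy
    refine ⟨norm_pos_iff.2 (sub_ne_zero.2 (hMB.ne_of_mem hx hy)), ?_⟩
    rw [← sq_lt_sq₀ (norm_nonneg _) (norm_nonneg _), norm_reflectAt_sub_sq]
    nlinarith [mul_pos (sub_pos.2 (hMl x hx)) (sub_pos.2 (hBl y hy))]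
  rcases (M ×ˢ B).eq_empty_or_nonempty with hem | hne
  · refine ⟨1, one_pos, fun x hx y hy => ?_⟩
    exact absurd (show (x, y) ∈ M ×ˢ B from ⟨hx, hy⟩) (by simp [hem])
  have hcont : ContinuousOn (fun p : EuclideanSpace ℝ (Fin N) × EuclideanSpace ℝ (Fin N) =>
      fullKernel (p.1 - p.2) - fullKernel (reflectAt l p.1 - p.2)) (M ×ˢ B) := by
    have hR := continuous_reflectAt (N := N) l
    have c1 : Continuous fun p : EuclideanSpace ℝ (Fin N) × EuclideanSpace ℝ (Fin N) =>
        ‖p.1 - p.2‖ ^ N := by fun_prop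
    have c2 : Continuous fun p : EuclideanSpace ℝ (Fin N) × EuclideanSpace ℝ (Fin N) =>
        ‖reflectAt l p.1 - p.2‖ ^ N := by fun_prop
    refine (continuousOn_const.div c1.continuousOn fun p hp => ?_).sub
      (continuousOn_const.div c2.continuousOn fun p hp => ?_)
    · exact (pow_pos (hpos _ hp.1 _ hp.2).1 N).ne'
    · exact (pow_pos ((hpos _ hp.1 _ hp.2).1.trans (hpos _ hp.1 _ hp.2).2) N).ne'
  obtain ⟨p, hp, hmin⟩ := (hM.prod hB).exists_isMinOn hne hcont
  obtain ⟨h1, h2⟩ := hpos _ hp.1 _ hp.2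
  refine ⟨fullKernel (p.1 - p.2) - fullKernel (reflectAt l p.1 - p.2), sub_pos.2 ?_,
    fun x hx y hy => isMinOn_iff.1 hmin (x, y) (mk_mem_prod hx hy)⟩
  exact div_lt_div_of_pos_left (logLapC_pos N) (pow_pos h1 N)
    (pow_lt_pow_left₀ h2 h1.le (NeZero.ne N))

namespace MovingPlaneData

/-- For `l > 0` the reflection of the far left part of `Ω` lies outside of `Ω`. There `u` is smaller
than its reflection by a definite amount, on a ball disjoint from `Ω`. -/
lemma exists_reflectDiff_le (D : MovingPlaneData Ω f u) (hl : 0 < l) (hne : Ω.Nonempty) :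
    ∃ b, ∃ ρ > 0, ∃ a > 0, (∀ x ∈ closedBall b ρ, x ∉ Ω) ∧
      (∀ y ∈ Ω, ∀ x ∈ closedBall b ρ, y 0 < x 0) ∧
      ∀ x ∈ closedBall b ρ, reflectDiff l u x ≤ -a := by
  obtain ⟨R, hR⟩ := D.isBounded.exists_norm_le
  have hbdd : BddAbove ((fun x : EuclideanSpace ℝ (Fin N) => x 0) '' Ω) := by
    refine ⟨R, ?_⟩
    rintro _ ⟨x, hx, rfl⟩
    exact (le_abs_self _).trans ((PiLp.norm_apply_le x 0).trans (hR x hx))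
  have hle : ∀ x ∈ Ω, x 0 ≤ sSup ((fun x : EuclideanSpace ℝ (Fin N) => x 0) '' Ω) :=
    fun x hx => le_csSup hbdd ⟨x, hx, rfl⟩
  obtain ⟨_, ⟨y, hy, rfl⟩, hys⟩ := exists_lt_of_lt_csSup (hne.image _)
    (sub_lt_self (sSup ((fun x : EuclideanSpace ℝ (Fin N) => x 0) '' Ω)) hl)
  set s := sSup ((fun x : EuclideanSpace ℝ (Fin N) => x 0) '' Ω)
  have hz := (D.symm y).2 hy
  set z := reflectFirst y with hzdef
  have hz0 : z 0 = -y 0 := by rw [hzdef, ← reflectAt_zero, reflectAt_apply_zero]; ring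
  have huz := D.pos z hz
  have hev : ∀ᶠ x in nhds z, x ∈ Ω ∧ u z / 2 < u x :=
    (D.isOpen.eventually_mem hz).and
      ((D.continuousOn.continuousAt (D.isOpen.mem_nhds hz)).eventually_const_lt (half_lt_self huz))
  obtain ⟨ρ, hρ, hball⟩ := Metric.eventually_nhds_iff_ball.1 hev
  have hcoord : ∀ x ∈ closedBall (reflectAt l z) (min (ρ / 2) l), s < x 0 := fun x hx => by
    have h1 : (reflectAt l z - x) 0 ≤ l := by
      refine (le_abs_self _).trans ((PiLp.norm_apply_le (reflectAt l z - x) 0).trans ?_)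
      rw [← dist_eq_norm, dist_comm]
      exact (mem_closedBall.1 hx).trans (min_le_right _ _)
    rw [PiLp.sub_apply, reflectAt_apply_zero, hz0] at h1
    linarith
  have hout : ∀ x ∈ closedBall (reflectAt l z) (min (ρ / 2) l), x ∉ Ω := fun x hx hxΩ =>
    absurd (hle x hxΩ) (not_le.2 (hcoord x hx))
  refine ⟨reflectAt l z, min (ρ / 2) l, by positivity, u z / 2, by positivity, hout,
    fun y hy x hx => (hle y hy).trans_lt (hcoord x hx), fun x hx => ?_⟩
  have h2 : reflectAt l x ∈ ball z ρ := by
    rw [mem_ball, dist_eq_norm, norm_reflectAt_sub, ← dist_eq_norm]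
    refine ((mem_closedBall.1 hx).trans (min_le_left _ _)).trans_lt (by linarith)
  have h3 := (hball _ h2).2
  rw [reflectDiff, D.zero x (hout x hx)]
  linarith

/-- The strong maximum principle: for `l > 0` the reflection inequality is strict in the interior of
the half-space. The difference of the two sides is compared with a small multiple of a tent
function, using that it has a definite size on a ball far away from the given point. -/
lemma lt_reflectAt (D : MovingPlaneData Ω f u) (hl : 0 < l)
    (hle : ∀ x ∈ Ω, l ≤ x 0 → u x ≤ u (reflectAt l x)) {x₀ : EuclideanSpace ℝ (Fin N)}
    (hx₀ : x₀ ∈ Ω) (hlx₀ : l < x₀ 0) : u x₀ < u (reflectAt l x₀) := by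
  by_contra hnot
  have hx₀w : reflectDiff l u x₀ = 0 := by
    rw [reflectDiff, sub_eq_zero]; exact le_antisymm (hle x₀ hx₀ hlx₀.le) (not_lt.1 hnot)
  have hw : ∀ x : EuclideanSpace ℝ (Fin N), l ≤ x 0 → reflectDiff l u x ≤ 0 := fun x hlx => by
    by_cases hx : x ∈ Ω
    · exact sub_nonpos.2 (hle x hx hlx)
    · rw [reflectDiff, D.zero x hx]
      linarith [D.nonneg (reflectAt l x)]
  obtain ⟨L, hL0, hL⟩ := D.lipschitz
  obtain ⟨b, ρ, hρ, a, ha, hbΩ, hbl, hba⟩ := D.exists_reflectDiff_le hl ⟨x₀, hx₀⟩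
  obtain ⟨δ, hδ, hcoer⟩ := exists_measure_le_logLapForm_self N 0
  -- a ball around `x₀` on which the form is nonnegative
  obtain ⟨r, hr, hrΩ, hrδ⟩ : ∃ r > 0, (∀ y ∈ closedBall x₀ r, y ∈ Ω ∧ l < y 0) ∧
      volume (closedBall x₀ r) ≤ ENNReal.ofReal δ := by
    have h1 : ∀ᶠ y in nhds x₀, y ∈ Ω ∧ l < y 0 :=
      (D.isOpen.eventually_mem hx₀).and
        (continuous_apply_zero.continuousAt.eventually_const_lt hlx₀)
    obtain ⟨r₁, hr₁, h1⟩ := Metric.nhds_basis_closedBall.eventually_iff.1 h1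
    have := nontrivial_euclideanSpace N
    have h2 : Filter.Tendsto (fun r => volume (closedBall x₀ r)) (nhdsWithin 0 (Ioi 0))
        (nhds 0) := by
      have h3 := (tendsto_measure_cthickening_of_isCompact (μ := volume)
        (isCompact_singleton (x := x₀))).mono_left (nhdsWithin_le_nhds (s := Ioi 0))
      rw [measure_singleton] at h3
      refine h3.congr' ?_
      filter_upwards [self_mem_nhdsWithin] with r hr
      rw [cthickening_singleton x₀ (le_of_lt hr)]
    have h3 := (h2.eventually_lt_const (ENNReal.ofReal_pos.2 hδ)).and
      (Ioo_mem_nhdsGT hr₁)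
    obtain ⟨r, h4, h5⟩ := h3.exists
    exact ⟨r, h5.1, fun y hy => h1 (closedBall_subset_closedBall h5.2.le hy), h4.le⟩
  have hdisj : Disjoint (closedBall b ρ) (closedBall x₀ r) :=
    Set.disjoint_left.2 fun x h1 h2 => hbΩ x h1 (hrΩ x h2).1
  obtain ⟨κ, hκ, hκle⟩ := exists_le_fullKernel_sub (isCompact_closedBall b ρ)
    (isCompact_closedBall x₀ r) (fun x hx => hlx₀.trans (hbl x₀ hx₀ x hx))
    (fun y hy => (hrΩ y hy).2) hdisj
  obtain ⟨R, hR⟩ := exists_antisymmTent_support l r x₀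
  obtain ⟨C, hC⟩ := exists_logLapForm_le_integral (abs_antisymmTent_sub_le (l := l) r x₀)
    (abs_antisymmTent_le hr.le x₀) hR
  have hg := admissible_of_lipschitz (abs_antisymmTent_sub_le (l := l) r x₀)
    (abs_antisymmTent_le hr.le x₀) hR
  have hV : 0 < volume.real (closedBall b ρ) :=
    ENNReal.toReal_pos (measure_closedBall_pos volume b hρ).ne' measure_closedBall_lt_top.ne
  -- `ε` is so small that the gain from the far ball beats the error terms
  obtain ⟨ε, hε, hεlt⟩ : ∃ ε > 0, ε * (C + L * r) < a * κ / 8 * volume.real (closedBall b ρ) := by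
    have hG : 0 < a * κ / 8 * volume.real (closedBall b ρ) := by positivity
    have hden : 0 < |C| + L * r + 1 := by positivity
    refine ⟨a * κ / 8 * volume.real (closedBall b ρ) / (|C| + L * r + 1), by positivity, ?_⟩
    rw [div_mul_eq_mul_div, div_lt_iff₀ hden]
    exact mul_lt_mul_of_pos_left (by linarith [le_abs_self C]) hG
  set g := antisymmTent l r x₀ with hgdef
  -- the comparison function `ε g + w`, in the form to which linearity of the form is applied
  set h : EuclideanSpace ℝ (Fin N) → ℝ := fun x => ε * g x - -1 * reflectDiff l u x with hhdef
  have hwadm := D.admissible_reflectDiff (l := l)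
  have hh : Admissible h := (hg.const_mul ε).sub (hwadm.const_mul (-1))
  have hanti : ∀ x, h (reflectAt l x) = -h x := fun x => by
    simp only [hhdef, hgdef, reflectDiff_reflectAt, antisymmTent_reflectAt]; ring
  have hφ := hh.posHalf hanti
  have hsupp : ∀ x, posHalf l h x ≠ 0 → x ∈ closedBall x₀ r := fun x hx => by
    obtain ⟨h1, h2⟩ := posHalf_ne_zero hx
    by_contra hout
    rw [mem_closedBall, dist_eq_norm, not_le] at hout
    have h3 : g x ≤ 0 := by
      refine (antisymmTent_le r x₀ x).trans (max_le (by linarith) le_rfl)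
    have h4 := mul_nonpos_of_nonneg_of_nonpos hε.le h3
    simp only [hhdef] at h2
    linarith [hw x h1]
  have e1 := hcoer _ _ hφ posHalf_nonneg measurableSet_closedBall hrδ hsupp
  rw [zero_mul] at e1
  have e2 := logLapForm_posHalf_add_le hh hanti (M := closedBall b ρ) measurableSet_closedBall
    measure_closedBall_lt_top.ne (fun x hx => (hlx₀.trans (hbl x₀ hx₀ x hx)).le) (κ := a * κ)
    fun x hx y hy => by
      have h1 := hκle x hx y (hsupp y hy)
      have h2 : a ≤ max (-h x) 0 := by
        refine le_trans ?_ (le_max_left _ _)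
        have h3 : x ∉ closedBall x₀ r := Set.disjoint_left.1 hdisj hx
        rw [mem_closedBall, dist_eq_norm, not_le] at h3
        have h4 : g x ≤ 0 :=
          (antisymmTent_le r x₀ x).trans (max_le (by linarith) le_rfl)
        have h5 := mul_nonpos_of_nonneg_of_nonpos hε.le h4
        simp only [hhdef]
        linarith [hba x hx]
      exact mul_le_mul h2 h1 hκ.le (ha.le.trans h2)
  have e3 : logLapForm h (posHalf l h) = ε * logLapForm g (posHalf l h)
      + logLapForm (reflectDiff l u) (posHalf l h) := by
    rw [hhdef, logLapForm_sub_left (hg.const_mul ε) (hwadm.const_mul (-1)) hφ,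
      logLapForm_const_mul_left, logLapForm_const_mul_left]
    ring
  obtain ⟨hint, e4⟩ := D.logLapForm_reflectDiff hφ posHalf_nonneg hl.le
    fun x hx => ⟨(hrΩ x (hsupp x hx)).1, (posHalf_ne_zero hx).1⟩
  have e5 := mul_le_mul_of_nonneg_left (hC _ hφ posHalf_nonneg) hε.le
  have e6 : ∫ x, (f (u x) - f (u (reflectAt l x))) * posHalf l h x ≤
      (L * (ε * r)) * ∫ x, posHalf l h x := by
    rw [← integral_const_mul]
    refine integral_mono hint (hφ.integrable.const_mul _) fun x => ?_
    by_cases hx : posHalf l h x = 0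
    · simp [hx]
    refine mul_le_mul_of_nonneg_right ?_ (posHalf_nonneg x)
    obtain ⟨h1, h2⟩ := posHalf_ne_zero hx
    refine ((le_abs_self _).trans (hL x (reflectAt l x))).trans
      (mul_le_mul_of_nonneg_left ?_ hL0)
    have h3 : g x ≤ r := (le_abs_self _).trans (abs_antisymmTent_le hr.le x₀ x)
    have h4 := mul_le_mul_of_nonneg_left h3 hε.le
    have h5 : |u x - u (reflectAt l x)| = -reflectDiff l u x := abs_of_nonpos (hw x h1)
    rw [h5]
    simp only [hhdef] at h2
    linarith
  have hφ0 : ∫ x, posHalf l h x = 0 := by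
    refine le_antisymm ?_ (integral_nonneg posHalf_nonneg)
    by_contra! hpos
    have := mul_lt_mul_of_pos_right hεlt hpos
    rw [e3, e4] at e2
    linarith
  rw [integral_eq_zero_iff_of_nonneg posHalf_nonneg hφ.integrable] at hφ0
  have hcont : ContinuousAt h x₀ :=
    ((continuous_antisymmTent r x₀).continuousAt.const_mul ε).sub
      ((D.continuousAt_reflectDiff hl.le hx₀ hlx₀.le).const_mul (-1))
  have hfin := le_zero_of_posHalf_ae_zero hφ0 hcont hlx₀
  have hgx₀ : 0 < g x₀ := by
    have h1 : 0 < ‖reflectAt l x₀ - x₀‖ := by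
      rw [norm_pos_iff, sub_ne_zero]
      intro h2
      have h3 := reflectAt_apply_zero l x₀
      rw [h2] at h3
      linarith
    rw [hgdef, antisymmTent, sub_self, norm_zero, sub_zero, max_eq_left hr.le, sub_pos]
    exact max_lt (by linarith) hr
  simp only [hhdef, hx₀w] at hfin
  nlinarith [mul_pos hε hgx₀]

/-- The reflection inequality holds for every hyperplane to the right of `{x₁ = 0}`. At the infimum
`s` of the positions down to which it holds it is strict, so to the left of `s` it can fail only on a
set whose measure tends to zero, and the maximum principle in sets of small measure applies. This
argument also covers positions beyond `Ω`, where the inequality is void. -/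
lemma le_reflectAt (D : MovingPlaneData Ω f u) (hl : 0 < l) :
    ∀ x ∈ Ω, l ≤ x 0 → u x ≤ u (reflectAt l x) := by
  by_contra hfail
  obtain ⟨δ, hδ, hsmall⟩ := D.exists_measure_le_reflect
  set P : ℝ → Prop := fun l => ∀ x ∈ Ω, l ≤ x 0 → u x ≤ u (reflectAt l x) with hP
  set S : Set ℝ := {m | 0 < m ∧ ∀ m' ≥ m, P m'} with hS
  obtain ⟨R, hR⟩ := D.isBounded.exists_norm_le
  have hSne : S.Nonempty := by
    refine ⟨|R| + 1, by positivity, fun m hm x hx hmx => ?_⟩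
    have h1 := (le_abs_self _).trans ((PiLp.norm_apply_le x 0).trans (hR x hx))
    linarith [le_abs_self R]
  have hSl : ∀ m ∈ S, l < m := fun m hm => by
    by_contra! hle
    exact hfail (hm.2 l hle)
  have hSbdd : BddBelow S := ⟨l, fun m hm => (hSl m hm).le⟩
  set s := sInf S with hs
  have hls : l ≤ s := le_csInf hSne fun m hm => (hSl m hm).le
  have hs0 : 0 < s := hl.trans_le hls
  have hPgt : ∀ m, s < m → P m := fun m hm => by
    obtain ⟨m', hm', hlt⟩ := exists_lt_of_csInf_lt hSne hm
    exact hm'.2 m hlt.le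
  -- the inequality passes to the limit position
  have hPs : P s := fun x hx hsx => by
    rcases hsx.eq_or_lt with h0 | h0
    · simp [reflectAt, h0]
    have hc : Filter.Tendsto (fun m => u (reflectAt m x)) (nhdsWithin s (Ioi s))
        (nhds (u (reflectAt s x))) :=
      ((D.continuousOn.continuousAt (D.isOpen.mem_nhds (D.reflectAt_mem hs0.le hx hsx))).tendsto.comp
        (continuous_reflectAt_left x).continuousAt.tendsto).mono_left nhdsWithin_le_nhds
    refine ge_of_tendsto hc ?_
    filter_upwards [Ioo_mem_nhdsGT h0] with m hm
    exact hPgt m hm.1 x hx hm.2.le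
  -- slightly to the left of it, the inequality fails at most on a small set
  have hlim : Filter.Tendsto
      (fun m => volume {x | x ∈ Ω ∧ m ≤ x 0 ∧ 0 < reflectDiff m u x}) (nhdsWithin s (Iio s))
      (nhds (volume (∅ : Set (EuclideanSpace ℝ (Fin N))))) := by
    refine tendsto_measure_of_ae_tendsto_indicator _ MeasurableSet.empty (fun m => ?_)
      D.isOpen.measurableSet D.isBounded.measure_lt_top.ne
      (Filter.Eventually.of_forall fun m x hx => hx.1) ?_
    · exact D.isOpen.measurableSet.inter ((measurableSet_le measurable_const
        continuous_apply_zero.measurable).inter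
        (measurableSet_lt measurable_const D.admissible_reflectDiff.measurable))
    · have hnull : ∀ᵐ x : EuclideanSpace ℝ (Fin N), x 0 ≠ s := by
        simpa [ae_iff] using volume_hyperplane s
      filter_upwards [hnull] with x hx
      by_cases hxΩ : x ∈ Ω
      swap
      · simp [hxΩ]
      rcases lt_or_gt_of_ne hx with hlt | hgt
      · filter_upwards [Ioo_mem_nhdsLT hlt] with m hm
        simp [not_le.2 hm.1]
      · have hc : Filter.Tendsto (fun m => reflectDiff m u x) (nhdsWithin s (Iio s))
            (nhds (reflectDiff s u x)) :=
          (((D.continuousOn.continuousAt (D.isOpen.mem_nhds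
            (D.reflectAt_mem hs0.le hxΩ hgt.le))).tendsto.comp
            (continuous_reflectAt_left x).continuousAt.tendsto).mono_left
            nhdsWithin_le_nhds).const_sub (u x)
        have hneg : reflectDiff s u x < 0 := sub_neg.2 (D.lt_reflectAt hs0 hPs hxΩ hgt)
        filter_upwards [hc.eventually_lt_const hneg] with m hm
        simp [hm.le]
  rw [measure_empty] at hlim
  have hev := (hlim.eventually_lt_const (ENNReal.ofReal_pos.2 hδ)).and (Ioo_mem_nhdsLT hs0)
  have hPev : ∀ᶠ m in nhdsWithin s (Iio s), 0 < m ∧ P m := by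
    filter_upwards [hev] with m hm
    exact ⟨hm.2.1, hsmall m hm.2.1.le hm.1.le⟩
  obtain ⟨m₀, hm₀, hIoo⟩ := (mem_nhdsLT_iff_exists_Ioo_subset' (show s - 1 < s by linarith)).1 hPev
  obtain ⟨m, hm₀m, hms⟩ := exists_between (show m₀ < s from hm₀)
  have hmS : m ∈ S := by
    refine ⟨(hIoo ⟨hm₀m, hms⟩).1, fun m' hm' => ?_⟩
    rcases lt_trichotomy m' s with h1 | h1 | h1
    · exact (hIoo ⟨hm₀m.trans_le hm', h1⟩).2
    · rw [h1]; exact hPs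
    · exact hPgt m' h1
  exact absurd (csInf_le hSbdd hmS) (not_le.2 hms)

/-- The limit `l → 0` of the reflection inequality. -/
lemma le_reflectFirst (D : MovingPlaneData Ω f u) {x : EuclideanSpace ℝ (Fin N)} (hx : x ∈ Ω)
    (hx0 : 0 ≤ x 0) : u x ≤ u (reflectFirst x) := by
  rw [← reflectAt_zero]
  rcases hx0.eq_or_lt with h0 | h0
  · simp [reflectAt, ← h0]
  have hc : Filter.Tendsto (fun m => u (reflectAt m x)) (nhdsWithin 0 (Ioi 0))
      (nhds (u (reflectAt 0 x))) :=
    ((D.continuousOn.continuousAt (D.isOpen.mem_nhds (D.reflectAt_mem le_rfl hx hx0))).tendsto.comp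
      (continuous_reflectAt_left x).continuousAt.tendsto).mono_left nhdsWithin_le_nhds
  refine ge_of_tendsto hc ?_
  filter_upwards [Ioo_mem_nhdsGT h0] with m hm
  exact D.le_reflectAt hm.1 x hx hm.2.le

lemma comp_reflectFirst (D : MovingPlaneData Ω f u) :
    MovingPlaneData Ω f (fun x => u (reflectAt 0 x)) := by
  have hsymm : ∀ x, reflectAt 0 x ∈ Ω ↔ x ∈ Ω := fun x => by rw [reflectAt_zero]; exact D.symm x
  obtain ⟨L, hL0, hL⟩ := D.lipschitz
  refine ⟨D.isOpen, D.isBounded, D.convex, D.symm, D.continuous_f, D.admissible.comp_reflectAt 0,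
    D.continuousOn.comp (continuous_reflectAt 0).continuousOn fun x hx => (hsymm x).2 hx,
    fun x hx => D.pos _ ((hsymm x).2 hx), fun x hx => D.zero _ (mt (hsymm x).1 hx),
    ⟨L, hL0, fun x y => hL _ _⟩, fun φ hφ hpos hzero => ?_⟩
  rw [logLapForm_comp_reflectAt, D.solution _ (hφ.comp_reflectAt 0) (fun x => hpos _)
    fun x hx => hzero _ (mt (hsymm x).1 hx), ← integral_comp_reflectAt _ 0]
  simp only [reflectAt_reflectAt]

/-- Both `u` and its reflection satisfy the inequality `le_reflectFirst`, and for the reflection it is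
the converse one. -/
lemma reflectFirst_eq (D : MovingPlaneData Ω f u) (x : EuclideanSpace ℝ (Fin N)) :
    u (reflectFirst x) = u x := by
  have key : ∀ x ∈ Ω, 0 ≤ x 0 → u (reflectFirst x) = u x := fun x hx hx0 => by
    refine le_antisymm ?_ (D.le_reflectFirst hx hx0)
    have := D.comp_reflectFirst.le_reflectFirst hx hx0
    rwa [← reflectAt_zero, reflectAt_reflectAt, reflectAt_zero] at this
  by_cases hx : x ∈ Ω
  · rcases le_total 0 (x 0) with h0 | h0
    · exact key x hx h0
    · have h1 := key _ ((D.symm x).2 hx) (by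
        rw [← reflectAt_zero, reflectAt_apply_zero]; linarith)
      rw [← reflectAt_zero (reflectFirst x), ← reflectAt_zero x, reflectAt_reflectAt] at h1
      rw [h1, reflectAt_zero]
  · rw [D.zero x hx, D.zero _ (mt (D.symm x).1 hx)]

lemma add_smul_lt (D : MovingPlaneData Ω f u) {x : EuclideanSpace ℝ (Fin N)} (hx0 : 0 < x 0)
    {t : ℝ} (ht : 0 < t) (hxt : x + t • e1 N ∈ Ω) : u (x + t • e1 N) < u x := by
  have hl : 0 < x 0 + t / 2 := by positivity
  have h0 : (x + t • e1 N) 0 = x 0 + t := by simp [e1_apply_zero]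
  have h1 : reflectAt (x 0 + t / 2) (x + t • e1 N) = x := by
    rw [reflectAt, h0]
    module
  have := D.lt_reflectAt hl (D.le_reflectAt hl) hxt (by rw [h0]; linarith)
  rwa [h1] at this

end MovingPlaneData

end StrongMaximumPrinciple

/-! ### Symmetry and monotonicity -/

theorem mainTheorem1 (N : ℕ) [NeZero N] (Ω : Set (EuclideanSpace ℝ (Fin N)))
    (hΩ_open : IsOpen Ω) (hΩ_bdd : Bornology.IsBounded Ω) (hΩ_lip : HasLipschitzBoundary Ω)
    (hΩ_convex : ConvexInDirection (e1 N) Ω)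
    (hΩ_symm : ∀ x, reflectFirst x ∈ Ω ↔ x ∈ Ω)
    (f : ℝ → ℝ) (hf : LocallyLipschitz f)
    (u : EuclideanSpace ℝ (Fin N) → ℝ)
    (hu_cont : ContinuousOn u (closure Ω)) (hu_mem : MemHspaceOn Ω u)
    (hu_pos : ∀ x ∈ Ω, 0 < u x)
    (hu_sol : IsWeakSolution Ω (fun x => f (u x)) u)
    (hu_ext : ∀ x ∉ Ω, u x = 0) :
    (∀ x, u (reflectFirst x) = u x) ∧
      ∀ x ∈ Ω, 0 < x 0 → ∀ t : ℝ, 0 < t → x + t • e1 N ∈ Ω → u (x + t • e1 N) < u x := by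
  classical
  have hmeas : Measurable u := by
    have h1 : Ω.piecewise u 0 = u := by
      ext x
      by_cases hx : x ∈ Ω
      · simp [hx]
      · simp [hx, hu_ext x hx]
    rw [← h1]
    exact (hu_cont.mono subset_closure).measurable_piecewise continuousOn_const
      hΩ_open.measurableSet
  obtain ⟨M, hM⟩ := hΩ_bdd.isCompact_closure.exists_bound_of_continuousOn hu_cont
  have hbd : ∀ x, |u x| ≤ max M 0 := fun x => by
    by_cases hx : x ∈ Ω
    · exact (hM x (subset_closure hx)).trans (le_max_left _ _)
    · rw [hu_ext x hx, abs_zero]; exact le_max_right _ _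
  obtain ⟨R, hR⟩ := hΩ_bdd.exists_norm_le
  have hadm : Admissible u := by
    refine ⟨hmeas, ⟨_, hbd⟩, ⟨R + 1, fun x hx => ?_⟩, hu_mem.memHspace.finite_energy⟩
    rw [mem_ball_zero_iff]
    linarith [hR x (not_imp_comm.1 (hu_ext x) hx)]
  obtain ⟨L, hL⟩ := (hf.locallyLipschitzOn (s := Icc (-max M 0) (max M 0))
    ).exists_lipschitzOnWith_of_compact isCompact_Icc
  have D : MovingPlaneData Ω f u := by
    refine ⟨hΩ_open, hΩ_bdd, hΩ_convex, hΩ_symm, hf.continuous, hadm,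
      hu_cont.mono subset_closure, hu_pos, hu_ext, ⟨L, L.2, fun x y => ?_⟩,
      fun φ hφ hpos hzero => ?_⟩
    · have := hL.dist_le_mul (u x) (abs_le.1 (hbd x)) (u y) (abs_le.1 (hbd y))
      rwa [Real.dist_eq, Real.dist_eq] at this
    · have hmem : MemHspaceOn Ω φ := ⟨hφ.memHspace, Filter.Eventually.of_forall hzero⟩
      rw [← setIntegral_eq_integral_of_forall_compl_eq_zero (s := Ω)
        fun x hx => by rw [hzero x hx, mul_zero]]
      exact le_antisymm (hu_sol.2.2 φ hmem hpos) (hu_sol.1.2 φ hmem hpos)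
  exact ⟨D.reflectFirst_eq, fun x _ hx0 t ht hxt => D.add_smul_lt hx0 ht hxt⟩
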